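/- Let $r,q\ge 3$ be integers. Let $(r^q)$ denote the regular partition of the sphere $S^2$, the Euclidean plane $\mathbb R^2$ or the hyperbolic plane $H^2$ (according to whether $rq$ is less than, equal to or greater than $2(r+q)$) into regular $r$-gons, $q$ of them at each vertex. An $(r,q)$-polycycle is a simple planar $2$-connected finite or countable graph $G$ of girth $r$, with all vertex degrees at most $q$, that has an $(r,q)$-polycyclic realization, i.e. a drawing $P(G)$ in the plane without accumulation points such that (a) every interior vertex (one not on the boundary of an unbounded face) has degree $q$, (b) all interior (i.e. bounded) faces are combinatorial $r$-gons, and (c) any two different interior faces meet in an edge, in a vertex or in $\emptyset$. It is outerplanar if $P(G)$ has no interior vertices. An $(r,q)$-polycycle is proper if it is isomorphic to a (not necessarily induced) subgraph of the skeleton of $(r^q)$. A cell-homomorphism $f$ of $P(G)$ into $(r^{q'})$ maps vertices, edges and interior faces to vertices, edges and faces, preserves incidence, and is locally homeomorphic, i.e. does not fold two interior faces with a common edge onto one face. A set in $S^2$, $\mathbb R^2$ or $H^2$ is convex if any two of its points are joined by a shortest geodesic arc contained in the set. (i) Let $G$ be an outerplanar $(r,q)$-polycycle with realization $P(G)$.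 Then $G$ is a proper $(r,2q-2)$-polycycle; moreover $P(G)$ admits a cell-homomorphism into $(r^{2q-2})$, and for every such cell-homomorphism $f$ the projection $f(P(G))$ (the union of the closed image faces) is convex. (ii) Every outerplanar $(3,q)$-polycycle is a proper $(3,q+2)$-polycycle. -/

import Mathlib

universe u

/-! ## Drawings of graphs in the plane -/

/-- Rotation systems of a connected, locally finite graph: at each vertex, a cyclic order of the
darts (oriented edges) issuing from it. -/
structure RotationSystem {V : Type u} (G : SimpleGraph V) where
  /-- The next dart around the initial vertex. -/
  rot : Equiv.Perm G.Dart
  rot_fst : ∀ d, (rot d).fst = d.fst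
  rot_cyclic : ∀ d d' : G.Dart, d.fst = d'.fst → rot.SameCycle d d'

/-- The face permutation, which runs along the boundary of the face lying on a fixed side of a
dart; its orbits are the faces of the drawing. -/
def RotationSystem.next {V : Type u} {G : SimpleGraph V} (R : RotationSystem G) :
    Equiv.Perm G.Dart where
  toFun d := R.rot d.symm
  invFun d := (R.rot.symm d).symm
  left_inv d := by simp
  right_inv d := by simp

/-- A combinatorial drawing (plane map) of a connected, locally finite graph in the plane, finite
or infinite, without accumulation points. `bounded` is the set of all darts whose face is
bounded. -/
structure PlaneMap {V : Type u} (G : SimpleGraph V) extends RotationSystem G where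
  /-- The darts on the boundaries of the bounded faces. -/
  bounded : Set G.Dart
  /-- `bounded` is a union of faces. -/
  bounded_next : ∀ d, toRotationSystem.next d ∈ bounded ↔ d ∈ bounded
  /-- The boundary of a bounded face is finite. -/
  finite_of_bounded : ∀ d ∈ bounded, {d' | toRotationSystem.next.SameCycle d d'}.Finite
  /-- A finite drawing has exactly one unbounded face. -/
  unbounded_of_finite : Finite V →
    ∃ d, d ∉ bounded ∧ ∀ d', d' ∉ bounded → toRotationSystem.next.SameCycle d d'
  /-- In an infinite drawing the unbounded faces are those with infinite boundary. -/
  bounded_of_infinite : Infinite V →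
    ∀ d, {d' | toRotationSystem.next.SameCycle d d'}.Finite → d ∈ bounded
  /-- Planarity: every cycle `p` of the graph encloses a finite set of bounded faces (`S` is the
  set of their darts), the edges of `p` being precisely the edges that have such a face on exactly
  one of their two sides. For a finite connected graph this is equivalent to Euler's formula
  `V - E + F = 2`. -/
  jordan : ∀ (v : V) (p : G.Walk v v), p.IsCycle →
    ∃ S : Set G.Dart, S.Finite ∧ S ⊆ bounded ∧ (∀ d, toRotationSystem.next d ∈ S ↔ d ∈ S) ∧
      ∀ d : G.Dart, d.edge ∈ p.edges ↔ Xor (d ∈ S) (d.symm ∈ S)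

namespace PlaneMap

variable {V : Type u} {G : SimpleGraph V} (P : PlaneMap G)

/-- The vertices of the face of the dart `d`. -/
def faceVerts (d : G.Dart) : Set V := {v | ∃ d', P.next.SameCycle d d' ∧ d'.fst = v}

/-- The edges of the face of the dart `d`. -/
def faceEdges (d : G.Dart) : Set (Sym2 V) := {e | ∃ d', P.next.SameCycle d d' ∧ d'.edge = e}

/-- A vertex is interior if all faces around it are bounded, i.e. if it does not lie on the
boundary of an unbounded face. -/
def IsInteriorVertex (v : V) : Prop := ∀ d : G.Dart, d.fst = v → d ∈ P.bounded

/-- `(r,q)`-polycyclic realizations. The interior faces are the bounded ones. -/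
structure IsPolycyclicRealization (r q : ℕ) : Prop where
  /-- All interior vertices are of degree `q`. -/
  degree_eq : ∀ v, P.IsInteriorVertex v → (G.neighborSet v).encard = q
  /-- All interior faces are combinatorial `r`-gons. -/
  rgon : ∀ d ∈ P.bounded, (P.next ^ r) d = d ∧
    Set.InjOn (fun i : ℕ => ((P.next ^ i) d).fst) (Set.Iio r)
  /-- Two different interior faces meet in `∅`, in a vertex, or in an edge. -/
  inter : ∀ d ∈ P.bounded, ∀ d' ∈ P.bounded, ¬ P.next.SameCycle d d' →
    (P.faceVerts d ∩ P.faceVerts d').Subsingleton ∨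
      ∃ e ∈ P.faceEdges d ∩ P.faceEdges d', P.faceVerts d ∩ P.faceVerts d' = {v | v ∈ e}

/-- Outerplanarity: there are no interior vertices. -/
def IsOuterplanar : Prop := ∀ v, ¬ P.IsInteriorVertex v

end PlaneMap

/-- `2`-(vertex-)connected graphs. -/
def IsTwoConnected {V : Type u} (G : SimpleGraph V) : Prop :=
  3 ≤ ENat.card V ∧ G.Connected ∧ ∀ v : V, (G.induce {v}ᶜ).Connected

/-- `(r,q)`-polycycles. -/
structure IsPolycycle (r q : ℕ) {V : Type u} (G : SimpleGraph V) : Prop where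
  countable : Countable V
  twoConnected : IsTwoConnected G
  girth_eq : G.girth = r
  degree_le : ∀ v, (G.neighborSet v).encard ≤ q
  exists_realization : ∃ P : PlaneMap G, P.IsPolycyclicRealization r q

/-! ## The model plane of curvature `k` -/

/-- The simply connected surface of constant curvature `k` as a subset of `ℝ³`. The linear change
of coordinates `(x, y, z) ↦ (√|k| x, √|k| y, z)` identifies it with the unit sphere `S²` if
`0 < k` and with the upper sheet of the hyperboloid `z² - x² - y² = 1`, i.e. `H²`, if `k < 0`; for
`k = 0` it is the Euclidean plane `z = 1`. Geodesics are the sections by planes through `0`. -/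
def modelPlane (k : ℝ) : Set (Fin 3 → ℝ) :=
  {x | k * (x 0 ^ 2 + x 1 ^ 2) + x 2 ^ 2 = 1 ∧ (k ≤ 0 → 0 < x 2)}

/-- The closed convex region of the model plane spanned by a set of points; for two points that
are not antipodal it is the shortest geodesic arc between them, and for the vertices of a convex
polygon it is the closed polygon. -/
def geodesicHull (k : ℝ) (s : Set (Fin 3 → ℝ)) : Set (Fin 3 → ℝ) :=
  modelPlane k ∩ (PointedCone.hull ℝ s : Set (Fin 3 → ℝ))

/-- Convexity in the model plane: any two points of `A` are joined by a shortest geodesic arc in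
`A`. The arc is unique unless the points are antipodal points `x`, `-x` of the sphere; in that
case the arcs are the half great circles through the various third points `w`, so that by the
first condition one of them lies in `A` as soon as `A` contains a third point. -/
def IsGeodesicallyConvex (k : ℝ) (A : Set (Fin 3 → ℝ)) : Prop :=
  A ⊆ modelPlane k ∧
  (∀ x ∈ A, ∀ y ∈ A, y ≠ -x → geodesicHull k {x, y} ⊆ A) ∧
  ∀ x ∈ A, -x ∈ A → ∃ w ∈ A, w ≠ x ∧ w ≠ -x

/-- The matrix of the reflection of the model plane of curvature `k` in the geodesic
`l 0 * x + l 1 * y + l 2 * z = 0`. -/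
noncomputable def geodesicReflection (k : ℝ) (l : Fin 3 → ℝ) : Matrix (Fin 3) (Fin 3) ℝ :=
  1 - (2 / (l 0 ^ 2 + l 1 ^ 2 + k * l 2 ^ 2)) • Matrix.vecMulVec ![l 0, l 1, k * l 2] l

/-! ## The regular partition `(r^q)` -/

namespace RegularPartition

variable (r q : ℕ)

/-- Height of the vertices of the base polygon: the (hyperbolic) cosine of the circumradius of a
regular `r`-gon with angles `2π/q`. -/
noncomputable def height : ℝ := Real.cot (Real.pi / r) * Real.cot (Real.pi / q)

/-- Curvature of the plane carrying `(r^q)`, scaled so that the vertices of the base polygon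
below lie in it. It is positive, zero or negative according to `rq < 2(r+q)`, `rq = 2(r+q)` or
`rq > 2(r+q)`. -/
noncomputable def curvature : ℝ := 1 - height r q ^ 2

/-- The consecutive vertices of the base face, a regular `r`-gon with center `(0, 0, 1)`; the
sequence is periodic of period `r`. -/
noncomputable def baseVertex (i : ℕ) : Fin 3 → ℝ :=
  ![Real.cos ((2 * i + 1) * (Real.pi / r)), Real.sin ((2 * i + 1) * (Real.pi / r)), height r q]

/-- The symmetry group of `(r^q)`. It is generated by the reflections in the three sides of the
triangle with angles `π/r`, `π/2`, `π/q` whose corners are the center of the base face, the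
midpoint of one of its edges, and the end point `baseVertex r q 0` of this edge. (The monoid
generated by these involutions is a group.) -/
noncomputable def symmetries : Submonoid (Matrix (Fin 3) (Fin 3) ℝ) :=
  Submonoid.closure
    {geodesicReflection (curvature r q) ![0, 1, 0],
     geodesicReflection (curvature r q)
       ![Real.sin (Real.pi / r), -Real.cos (Real.pi / r), 0],
     geodesicReflection (curvature r q) ![height r q, 0, -Real.cos (Real.pi / r)]}

/-- The vertices of `(r^q)`. -/
def vertices : Set (Fin 3 → ℝ) :=
  {x | ∃ g ∈ symmetries r q, ∃ i, x = g.mulVec (baseVertex r q i)}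

/-- The skeleton of `(r^q)`: two vertices are adjacent if they are consecutive vertices of a face,
i.e. of an image of the base face under a symmetry. -/
def skeleton : SimpleGraph (vertices r q) :=
  SimpleGraph.fromRel fun x y => ∃ g ∈ symmetries r q, ∃ i,
    x.1 = g.mulVec (baseVertex r q i) ∧ y.1 = g.mulVec (baseVertex r q (i + 1))

end RegularPartition

/-- Proper `(r,q)`-polycycles: those isomorphic to a (not necessarily induced) subgraph of the
skeleton of `(r^q)`. -/
def IsProperPolycycle (r q : ℕ) {V : Type u} (G : SimpleGraph V) : Prop :=
  IsPolycycle r q G ∧ G.IsContained (RegularPartition.skeleton r q)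

namespace PlaneMap

variable {V : Type u} {G : SimpleGraph V} (P : PlaneMap G)

/-- Cell-homomorphisms of a realization into `(r^q)`. They map vertices to vertices, edges to
edges and interior faces to faces, preserving incidence, and they are locally homeomorphic, i.e.
two interior faces with a common edge are not folded onto the same face. -/
structure IsCellHom (r q : ℕ) (f : G →g RegularPartition.skeleton r q) : Prop where
  map_face : ∀ d ∈ P.bounded, ∃ g ∈ RegularPartition.symmetries r q, ∀ i : ℕ,
    (f ((P.next ^ i) d).fst).1 = g.mulVec (RegularPartition.baseVertex r q i)
  not_folded : ∀ d ∈ P.bounded, d.symm ∈ P.bounded →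
    f '' P.faceVerts d ≠ f '' P.faceVerts d.symm

/-- The projection `f(P(G))`, the union of the closed faces that are images of interior faces. -/
def projection {r q : ℕ} (f : G →g RegularPartition.skeleton r q) : Set (Fin 3 → ℝ) :=
  ⋃ d ∈ P.bounded, geodesicHull (RegularPartition.curvature r q)
    ((fun v => (f v).1) '' P.faceVerts d)

end PlaneMap

/-! ## Cochains vanishing on cycles -/

namespace SimpleGraph

variable {V : Type u} {G : SimpleGraph V}

/-! The bounded faces of an outerplanar realization, linked across shared edges, form a tree. Both
ends of a shared edge touch the unbounded region, so the edge separates the faces on its two sides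
(`exists_side`). Planarity is used only modulo 2: a cochain that counts crossings with a closed dual
curve vanishes on all cycles, hence is a coboundary, and its potential is the required
two-colouring.

On a tree there is no monodromy (`holonomy_eq_one`). Hence the faces can be unrolled into `(r^n)`,
one half-turn per crossed edge, for every `n ≥ 3` (`exists_isDevelopment`). Conversely every
cell-homomorphism is such a development, because the only other way to continue across an edge is to
fold (`IsCellHom.exists_isDevelopment`). All geometry is expressed by linear functionals on `ℝ³`,
one for each edge of the base face (`edgeFun`), which treats the three curvatures together.

For `n = 2q - 2`, at most `q - 1` bounded faces meet at a vertex, and `q - 1` faces of `(r^n)` fill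
exactly a straight angle. Along a chain of faces the first face therefore stays in certain
half-planes through the ends of the edge just crossed (`InHalfPlanes.step`). In particular it lies
behind every edge crossed later. So new vertices never meet old ones, and the segment from the first
face to the last never leaves the chain (`exists_mem_face_of_nonneg_combination`).

For triangles and `n = q + 2` the angle at a vertex may exceed `π`, and lines through edges no
longer separate. Lines through the midpoints of two sides of a triangle do: the invariant
`InMidlineHalfPlanes` keeps the first triangle on one side of several such midlines, among them the
one that cuts off the apex of the next triangle. The invariant is useful while `s + 3 ≤ n`, where `s
≤ q - 1` triangles share a vertex, which is the origin of `q + 2`. -/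

theorem sum_edges_eq_bypass (c : Sym2 V → ZMod 2)
    (hc : ∀ (v : V) (p : G.Walk v v), p.IsCycle → (p.edges.map c).sum = 0)
    [DecidableEq V] {a b : V} (p : G.Walk a b) :
    (p.edges.map c).sum = (p.bypass.edges.map c).sum := by
  induction p with
  | nil => rfl
  | @cons u v w h p ih =>
    rw [Walk.edges_cons, List.map_cons, List.sum_cons, ih]
    have hb : (Walk.cons h p).bypass =
        if hs : u ∈ p.bypass.support then p.bypass.dropUntil u hs else Walk.cons h p.bypass := rfl
    rw [hb]
    split_ifs with hs
    · have hsplit : (p.bypass.edges.map c).sum =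
          ((p.bypass.takeUntil u hs).edges.map c).sum +
            ((p.bypass.dropUntil u hs).edges.map c).sum := by
        conv_lhs => rw [← Walk.take_spec p.bypass hs]
        rw [Walk.edges_append, List.map_append, List.sum_append]
      rw [hsplit, ← add_assoc]
      have hpath : (p.bypass.takeUntil u hs).IsPath := p.bypass_isPath.takeUntil hs
      suffices H : c s(u, v) + ((p.bypass.takeUntil u hs).edges.map c).sum = 0 by
        rw [H, zero_add]
      -- The loop removed by the bypass is a cycle unless the path already uses the new edge. In
      -- that case the path consists of this edge alone, which is run back and forth and contributes
      -- `c + c = 0`.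
      by_cases he : s(u, v) ∈ (p.bypass.takeUntil u hs).edges
      · generalize p.bypass.takeUntil u hs = q at hpath he
        cases q with
        | nil => simp at he
        | @cons _ x _ h' q' =>
          rw [Walk.cons_isPath_iff] at hpath
          rw [Walk.edges_cons, List.mem_cons] at he
          rcases he with he | he
          · have hux : u = x := by
              rw [Sym2.eq_iff] at he
              rcases he with ⟨h1, h2⟩ | ⟨h1, -⟩
              · exact absurd h1 h.ne
              · exact h1
            subst hux
            have := (Walk.isPath_iff_nil.1 hpath.1).eq_nil
            subst this
            simp [Sym2.eq_swap, CharTwo.add_self_eq_zero]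
          · exact absurd (Walk.snd_mem_support_of_mem_edges _ he) hpath.2
      · have := hc _ _ ((Walk.cons_isCycle_iff _ h).2 ⟨hpath, he⟩)
        simpa using this
    · rw [Walk.edges_cons, List.map_cons, List.sum_cons]

/-- Sum `c` along any walk from `u`. The choice of walk does not matter, since a closed walk has the
same sum as its bypass, the empty path. -/
theorem exists_potential (hG : G.Connected) (c : Sym2 V → ZMod 2)
    (hc : ∀ (v : V) (p : G.Walk v v), p.IsCycle → (p.edges.map c).sum = 0) (u : V) :
    ∃ χ : V → ZMod 2, χ u = 0 ∧ ∀ a b, G.Adj a b → χ a + χ b = c s(a, b) := by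
  classical
  have hclosed : ∀ (v : V) (p : G.Walk v v), (p.edges.map c).sum = 0 := fun v p => by
    rw [sum_edges_eq_bypass c hc, (Walk.isPath_iff_nil.1 p.bypass_isPath).eq_nil]
    rfl
  have w : ∀ v, G.Walk u v := fun v => (hG.preconnected u v).some
  refine ⟨fun v => ((w v).edges.map c).sum, hclosed _ _, fun a b hab => ?_⟩
  have := hclosed _ ((w a).append (Walk.cons hab (w b).reverse))
  rw [Walk.edges_append, Walk.edges_cons, Walk.edges_reverse, List.map_append, List.map_cons,
    List.map_reverse, List.sum_append, List.sum_cons, List.sum_reverse] at this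
  have h2 := CharTwo.add_self_eq_zero (c s(a, b))
  linear_combination this - h2

theorem eq_of_forall_adj_of_induce_connected {v : V} (hv : (G.induce {v}ᶜ).Connected)
    {α : Type*} (χ : V → α) (h : ∀ a b, G.Adj a b → a ≠ v → b ≠ v → χ a = χ b) {a b : V}
    (ha : a ≠ v) (hb : b ≠ v) : χ a = χ b := by
  obtain ⟨p⟩ := hv.preconnected ⟨a, ha⟩ ⟨b, hb⟩
  have key : ∀ x y : ({v}ᶜ : Set V), (G.induce {v}ᶜ).Walk x y → χ x = χ y := by
    intro x y p
    induction p with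
    | nil => rfl
    | @cons x y z hxy p ih => exact (h _ _ hxy x.2 y.2).trans ih
  exact key _ _ p

theorem Dart.eq_of_fst_eq_of_edge_eq {d d' : G.Dart} (h : d.fst = d'.fst)
    (he : d.edge = d'.edge) : d = d' := by
  rcases (dart_edge_eq_iff d d').1 he with h' | h'
  · exact h'
  · exfalso
    rw [h'] at h
    exact d'.adj.ne h.symm

end SimpleGraph

/-! ## Darts around a vertex -/

namespace RotationSystem

variable {V : Type u} {G : SimpleGraph V} (R : RotationSystem G)

theorem rot_pow_fst (d : G.Dart) (k : ℕ) : ((R.rot ^ k) d).fst = d.fst := by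
  induction k with
  | zero => rfl
  | succ k ih => rw [pow_succ', Equiv.Perm.mul_apply, R.rot_fst, ih]

theorem next_symm (d : G.Dart) : R.next d.symm = R.rot d := by
  simp [RotationSystem.next]

theorem next_fst (d : G.Dart) : (R.next d).fst = d.snd := by
  simp [RotationSystem.next, R.rot_fst]

/-- Pigeonhole: the first `n + 1` rotated darts end in at most `n` neighbours, and a dart is
determined by its two ends. -/
theorem exists_pow_rot_eq_self (d : G.Dart) {n : ℕ} (hn : (G.neighborSet d.fst).encard ≤ n) :
    ∃ k, 0 < k ∧ k ≤ n ∧ (R.rot ^ k) d = d := by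
  classical
  have hfin : (G.neighborSet d.fst).Finite := Set.finite_of_encard_le_coe hn
  have hcard : hfin.toFinset.card ≤ n := by
    rw [hfin.encard_eq_coe_toFinset_card] at hn
    exact_mod_cast hn
  obtain ⟨i, hi, j, hj, hij, h⟩ := Finset.exists_ne_map_eq_of_card_lt_of_maps_to
    (s := Finset.range (n + 1)) (t := hfin.toFinset) (by simpa using Nat.lt_succ_of_le hcard)
    (f := fun i => ((R.rot ^ i) d).snd) (by
      intro i _
      have := ((R.rot ^ i) d).adj
      rw [R.rot_pow_fst] at this
      simpa using this)
  have key : ∀ i j : ℕ, i < j → j ≤ n → ((R.rot ^ i) d).snd = ((R.rot ^ j) d).snd →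
      ∃ k, 0 < k ∧ k ≤ n ∧ (R.rot ^ k) d = d := by
    intro i j hij hj h
    refine ⟨j - i, by omega, by omega, ?_⟩
    have h2 : (R.rot ^ i) d = (R.rot ^ j) d :=
      SimpleGraph.Dart.ext _ _ (Prod.ext (by
        rw [R.rot_pow_fst, R.rot_pow_fst]) h)
    have h3 : R.rot ^ j = R.rot ^ i * R.rot ^ (j - i) := by
      rw [← pow_add]; congr 1; omega
    rw [h3, Equiv.Perm.mul_apply] at h2
    exact ((R.rot ^ i).injective h2).symm
  simp only [Finset.mem_range] at hi hj
  rcases lt_or_gt_of_ne hij with h' | h'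
  · exact key i j h' (by omega) h
  · exact key j i h' (by omega) h.symm

theorem exists_pow_rot_eq {d d' : G.Dart} (h : d.fst = d'.fst) {n : ℕ}
    (hn : (G.neighborSet d.fst).encard ≤ n) : ∃ k < n, (R.rot ^ k) d = d' := by
  obtain ⟨p, hp, hpn, hpd⟩ := R.exists_pow_rot_eq_self d hn
  obtain ⟨z, hz⟩ := R.rot_cyclic d d' h
  have hp' : (0 : ℤ) < p := by exact_mod_cast hp
  have hmod := Int.emod_nonneg z hp'.ne'
  have hlt := Int.emod_lt_of_pos z hp'
  refine ⟨(z % p).toNat, by omega, ?_⟩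
  have h1 : (R.rot ^ (z % (p : ℤ))) d = d' := by
    have h2 : z = z % p + p * (z / p) := (Int.emod_add_mul_ediv z p).symm
    have h3 : ((R.rot ^ p) ^ (z / p)) d = d := Equiv.Perm.zpow_apply_eq_self_of_apply_eq_self hpd _
    rw [h2, zpow_add, Equiv.Perm.mul_apply, zpow_mul, zpow_natCast, h3] at hz
    exact hz
  rw [← h1, ← zpow_natCast, Int.toNat_of_nonneg hmod]

end RotationSystem

namespace PlaneMap

variable {V : Type u} {G : SimpleGraph V} (P : PlaneMap G)

open Classical in
/-- A nonempty set of consecutive darts around a vertex, from `a` (included) to `b` (excluded), and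
its indicator cochain, whose value on a cycle is determined by the sides on which `a` and `b`
lie. -/
theorem exists_arc {a b : G.Dart} (hab : a ≠ b) (h : a.fst = b.fst)
    (hfin : (G.neighborSet a.fst).Finite) :
    ∃ (A : Set G.Dart) (c : Sym2 V → ZMod 2), a ∈ A ∧ b ∉ A ∧ (∀ z ∈ A, z.fst = a.fst) ∧
      (∀ z ∈ A, P.rot z ≠ b → P.rot z ∈ A) ∧ (∀ z, P.rot z ∈ A → P.rot z ≠ a → z ∈ A) ∧
      (∀ z ∈ A, P.rot z ≠ a) ∧ (∀ z, P.rot z = b → z ∈ A) ∧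
      (∀ z : G.Dart, z.fst = a.fst → c z.edge = if z ∈ A then 1 else 0) ∧
      (∀ e, a.fst ∉ e → c e = 0) ∧
      ∀ (v : V) (p : G.Walk v v), p.IsCycle → ∀ S : Set G.Dart,
        (∀ d, P.next d ∈ S ↔ d ∈ S) → (∀ d : G.Dart, d.edge ∈ p.edges ↔ Xor (d ∈ S) (d.symm ∈ S)) →
        (p.edges.map c).sum = (if a ∈ S then 1 else 0) + if b ∈ S then 1 else 0 := by
  have hex : ∃ k, (P.rot ^ k) a = b := by
    obtain ⟨k, -, hk⟩ := P.exists_pow_rot_eq h (n := hfin.toFinset.card)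
      (by rw [hfin.encard_eq_coe_toFinset_card])
    exact ⟨k, hk⟩
  -- Minimality of `k` prevents the arc from winding around the vertex more than once, so its darts
  -- are distinct.
  set k := Nat.find hex with hkdef
  have hk : (P.rot ^ k) a = b := Nat.find_spec hex
  have hmin : ∀ i < k, (P.rot ^ i) a ≠ b := fun i hi => Nat.find_min hex hi
  have hk0 : 0 < k := by
    rcases Nat.eq_zero_or_pos k with h0 | h0
    · rw [h0] at hk; exact absurd hk hab
    · exact h0
  have hsucc : ∀ i, P.rot ((P.rot ^ i) a) = (P.rot ^ (i + 1)) a := fun i => by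
    rw [pow_succ', Equiv.Perm.mul_apply]
  have hper : ∀ i, 0 < i → i ≤ k → (P.rot ^ i) a ≠ a := by
    intro i hi hik hia
    apply hmin (k - i) (by omega)
    rw [← hk, show k = (k - i) + i by omega, pow_add, Equiv.Perm.mul_apply, hia]
    congr 2; congr 1; omega
  have hinj : ∀ i j, i < k → j < k → (P.rot ^ i) a = (P.rot ^ j) a → i = j := by
    have : ∀ i j, i < j → j < k → (P.rot ^ i) a ≠ (P.rot ^ j) a := by
      intro i j hij hj he
      rw [show j = i + (j - i) by omega, pow_add, Equiv.Perm.mul_apply] at he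
      exact hper (j - i) (by omega) (by omega) ((P.rot ^ i).injective he).symm
    intro i j hi hj he
    rcases lt_trichotomy i j with h' | h' | h'
    · exact absurd he (this i j h' hj)
    · exact h'
    · exact absurd he.symm (this j i h' hi)
  refine ⟨{z | ∃ i < k, (P.rot ^ i) a = z},
    fun e => ∑ i ∈ Finset.range k, if ((P.rot ^ i) a).edge = e then 1 else 0,
    ⟨0, hk0, rfl⟩, ?_, ?_, ?_, ?_, ?_, ?_, ?_, ?_, ?_⟩
  · rintro ⟨i, hi, hia⟩
    exact hmin i hi hia
  · rintro z ⟨i, hi, rfl⟩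
    exact P.rot_pow_fst _ _
  · rintro z ⟨i, hi, rfl⟩ hz
    refine ⟨i + 1, ?_, (hsucc i).symm⟩
    by_contra hlt
    apply hz
    rw [hsucc, show i + 1 = k by omega, hk]
  · rintro z ⟨i, hi, hz⟩ hza
    rcases i with _ | i
    · exact absurd hz.symm hza
    · rw [← hsucc] at hz
      exact ⟨i, by omega, P.rot.injective hz⟩
  · rintro z ⟨i, hi, rfl⟩
    rw [hsucc]
    exact hper _ (by omega) (by omega)
  · intro z hz
    refine ⟨k - 1, by omega, P.rot.injective ?_⟩
    rw [hsucc, hz, Nat.sub_add_cancel hk0, hk]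
  · intro z hz
    have hiff : ∀ i, ((P.rot ^ i) a).edge = z.edge ↔ (P.rot ^ i) a = z := fun i =>
      ⟨SimpleGraph.Dart.eq_of_fst_eq_of_edge_eq (by rw [P.rot_pow_fst, hz]), fun h => by rw [h]⟩
    simp only [hiff]
    split_ifs with hzA
    · obtain ⟨j, hj, hja⟩ := hzA
      rw [Finset.sum_eq_single j]
      · rw [if_pos hja]
      · intro i hi hij
        rw [if_neg]
        intro hia
        exact hij (hinj i j (Finset.mem_range.1 hi) hj (hia.trans hja.symm))
      · intro hj'
        exact absurd (Finset.mem_range.2 hj) hj'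
    · refine Finset.sum_eq_zero fun i hi => if_neg fun hia => hzA ⟨i, Finset.mem_range.1 hi, hia⟩
  · intro e he
    refine Finset.sum_eq_zero fun i hi => if_neg ?_
    rintro rfl
    apply he
    have : ((P.rot ^ i) a).fst ∈ ((P.rot ^ i) a).edge := by
      rw [SimpleGraph.Dart.edge]
      exact Sym2.mem_mk_left _ _
    rwa [P.rot_pow_fst] at this
  · intro v p hp S hS hpS
    -- The face of `d.symm` is that of `rot d`, so the edge of `d` contributes the difference
    -- between the two successive corners `d` and `rot d`. The sum over the arc then telescopes
    -- modulo 2.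
    have hone : ∀ d : G.Dart, (p.edges.map fun e => if d.edge = e then (1 : ZMod 2) else 0).sum =
        (if d ∈ S then 1 else 0) + if P.rot d ∈ S then 1 else 0 := by
      intro d
      have h1 : (p.edges.map fun e => if d.edge = e then (1 : ZMod 2) else 0).sum =
          if d.edge ∈ p.edges then 1 else 0 := by
        have hnd := hp.edges_nodup
        generalize p.edges = l at hnd
        induction l with
        | nil => simp
        | cons x l ih =>
          rw [List.nodup_cons] at hnd
          rw [List.map_cons, List.sum_cons, ih hnd.2]
          by_cases hx : d.edge = x
          · subst hx; simp [hnd.1]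
          · simp [hx]
      rw [h1, ← P.next_symm, hS]
      have h2 := hpS d
      by_cases hd : d ∈ S <;> by_cases hd' : d.symm ∈ S <;> simp [hd, hd', Xor] at h2 <;>
        simp [hd, hd', h2, CharTwo.add_self_eq_zero]
    have hsum : ∀ n, (p.edges.map fun e =>
        ∑ i ∈ Finset.range n, if ((P.rot ^ i) a).edge = e then (1 : ZMod 2) else 0).sum =
        (if a ∈ S then 1 else 0) + if (P.rot ^ n) a ∈ S then 1 else 0 := by
      intro n
      induction n with
      | zero => simp [CharTwo.add_self_eq_zero]
      | succ n ih =>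
        simp only [Finset.sum_range_succ]
        rw [List.sum_map_add, ih, hone, hsucc]
        have := CharTwo.add_self_eq_zero (if (P.rot ^ n) a ∈ S then (1 : ZMod 2) else 0)
        linear_combination this
    rw [hsum, hk]

end PlaneMap

/-! ## Outerplanar polycyclic realizations -/

namespace PlaneMap

variable {V : Type u} {G : SimpleGraph V}

/-- The properties of outerplanar polycyclic realizations from which their structure is derived. -/
structure IsOuterplanarRealization (P : PlaneMap G) (r q : ℕ) : Prop where
  three_le : 3 ≤ r
  connected : G.Connected
  induce_connected : ∀ v : V, (G.induce {v}ᶜ).Connected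
  exists_third : ∀ a b : V, ∃ w, w ≠ a ∧ w ≠ b
  degree_le : ∀ v, (G.neighborSet v).encard ≤ q
  next_pow : ∀ d ∈ P.bounded, (P.next ^ r) d = d
  injOn : ∀ d ∈ P.bounded, Set.InjOn (fun i : ℕ => ((P.next ^ i) d).fst) (Set.Iio r)
  exists_unbounded : ∀ v, ∃ d : G.Dart, d.fst = v ∧ d ∉ P.bounded

theorem IsPolycyclicRealization.isOuterplanarRealization {P : PlaneMap G} {r q : ℕ} (hr : 3 ≤ r)
    (hG : IsPolycycle r q G) (hP : P.IsPolycyclicRealization r q) (ho : P.IsOuterplanar) :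
    P.IsOuterplanarRealization r q where
  three_le := hr
  connected := hG.twoConnected.2.1
  induce_connected := hG.twoConnected.2.2
  exists_third a b := by
    by_contra! h
    have h1 : (Set.univ : Set V).encard ≤ 2 := by
      refine (Set.encard_le_encard (t := {a, b}) fun w _ => ?_).trans
        ((Set.encard_insert_le _ _).trans
          (by rw [Set.encard_singleton]; exact le_of_eq one_add_one_eq_two))
      by_cases hw : w = a
      · exact Or.inl hw
      · exact Or.inr (h w hw)
    have h2 := hG.twoConnected.1
    rw [Set.encard_univ] at h1
    exact absurd (h2.trans h1) (by decide)
  degree_le := hG.degree_le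
  next_pow d hd := (hP.rgon d hd).1
  injOn d hd := (hP.rgon d hd).2
  exists_unbounded v := by
    have := ho v
    unfold IsInteriorVertex at this
    push Not at this
    exact this

namespace IsOuterplanarRealization

variable {P : PlaneMap G} {r q : ℕ} (h : P.IsOuterplanarRealization r q)
include h

theorem finite_neighborSet (v : V) : (G.neighborSet v).Finite :=
  Set.finite_of_encard_le_coe (h.degree_le v)

/-- Otherwise the vertex would be a cut vertex. The arc between two unbounded corners has a cochain
that vanishes on cycles, because the set `S` of each cycle contains only bounded darts. Its
potential is constant off the vertex, yet it distinguishes the neighbours in the arc from those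
outside. -/
theorem unbounded_unique {d d' : G.Dart} (hd : d ∉ P.bounded) (hd' : d' ∉ P.bounded)
    (hv : d.fst = d'.fst) : d = d' := by
  by_contra hne
  obtain ⟨A, c, ha, hb, -, -, -, -, -, hc1, hc0, hcyc⟩ :=
    P.exists_arc hne hv (h.finite_neighborSet _)
  obtain ⟨χ, -, hχ⟩ := SimpleGraph.exists_potential h.connected c (by
    intro v p hp
    obtain ⟨S, -, hSb, hSn, hSp⟩ := P.jordan v p hp
    rw [hcyc v p hp S hSn hSp, if_neg fun hs => hd (hSb hs), if_neg fun hs => hd' (hSb hs),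
      add_zero]) d.fst
  have hconst := SimpleGraph.eq_of_forall_adj_of_induce_connected (h.induce_connected d.fst) χ (by
    intro a b hab ha hb
    have h1 := hχ a b hab
    rw [hc0 _ (by simp [ha.symm, hb.symm])] at h1
    exact CharTwo.add_eq_zero.1 h1) (a := d.snd) (b := d'.snd) d.adj.ne' (hv ▸ d'.adj.ne')
  have h1 := hχ _ _ d.adj
  have h2 := hχ _ _ d'.adj
  rw [show s(d.fst, d.snd) = d.edge from rfl, hc1 d rfl, if_pos ha] at h1
  rw [show s(d'.fst, d'.snd) = d'.edge from rfl, hc1 d' hv.symm, if_neg hb, ← hv, ← hconst] at h2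
  rw [h1] at h2
  exact one_ne_zero h2

/-- An edge without bounded faces lies on no cycle, so its indicator has a potential. Deleting
either end leaves a connected graph, on which the potential is constant. Comparison with a third
vertex makes it equal at both ends, although it must change along the edge. -/
theorem bounded_or_symm_bounded (d : G.Dart) : d ∈ P.bounded ∨ d.symm ∈ P.bounded := by
  classical
  by_contra! hd
  obtain ⟨χ, -, hχ⟩ := SimpleGraph.exists_potential h.connected
    (fun e => if e = d.edge then 1 else 0) (by
    intro v p hp
    obtain ⟨S, -, hSb, hSn, hSp⟩ := P.jordan v p hp
    have hdp : d.edge ∉ p.edges := by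
      rw [hSp d]
      have h1 : d ∉ S := fun hs => hd.1 (hSb hs)
      have h2 : d.symm ∉ S := fun hs => hd.2 (hSb hs)
      simp [Xor, h1, h2]
    refine List.sum_eq_zero fun x hx => ?_
    obtain ⟨e, he, rfl⟩ := List.mem_map.1 hx
    exact if_neg fun hed : e = d.edge => hdp (hed ▸ he)) d.fst
  have hzero : ∀ w, w ∈ d.edge → ∀ a b, a ≠ w → b ≠ w → χ a = χ b := fun w hw a b ha hb =>
    SimpleGraph.eq_of_forall_adj_of_induce_connected (h.induce_connected w) χ (by
      intro a b hab ha hb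
      have h1 := hχ a b hab
      rw [if_neg fun he => ?_] at h1
      · exact CharTwo.add_eq_zero.1 h1
      · rw [← he] at hw
        simp [ha.symm, hb.symm] at hw) ha hb
  obtain ⟨w, hwa, hwb⟩ := h.exists_third d.fst d.snd
  have h1 := hzero d.fst (Sym2.mem_mk_left _ _) w d.snd hwa d.adj.ne'
  have h2 := hzero d.snd (Sym2.mem_mk_right _ _) w d.fst hwb d.adj.ne
  have h3 := hχ _ _ d.adj
  rw [if_pos (show s(d.fst, d.snd) = d.edge from rfl), ← h1, ← h2, CharTwo.add_self_eq_zero] at h3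
  exact zero_ne_one h3

theorem exists_bounded (v : V) : ∃ d ∈ P.bounded, d.fst = v := by
  obtain ⟨d, hd, -⟩ := h.exists_unbounded v
  rcases h.bounded_or_symm_bounded d with hb | hb
  · exact ⟨d, hb, hd⟩
  · refine ⟨P.rot d, ?_, by rw [P.rot_fst, hd]⟩
    rw [← P.next_symm]
    exact (P.bounded_next _).2 hb

omit h in
theorem _root_.PlaneMap.next_pow_mem_bounded (P : PlaneMap G) {d : G.Dart} (hd : d ∈ P.bounded)
    (i : ℕ) : (P.next ^ i) d ∈ P.bounded := by
  induction i with
  | zero => exact hd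
  | succ i ih => rw [pow_succ', Equiv.Perm.mul_apply, P.bounded_next]; exact ih

/-- The bounded faces at a vertex are consecutive. -/
theorem eq_of_fst_eq {α : Sort*} {F : G.Dart → α}
    (hF : ∀ z ∈ P.bounded, P.rot z ∈ P.bounded → F z = F (P.rot z)) {z z' : G.Dart}
    (hz : z ∈ P.bounded) (hz' : z' ∈ P.bounded) (hzz' : z.fst = z'.fst) : F z = F z' := by
  obtain ⟨y, hy, hyu⟩ := h.exists_unbounded z.fst
  have key : ∀ w ∈ P.bounded, w.fst = y.fst → F w = F (P.rot y) := by
    intro w hw hwy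
    have hex : ∃ a, (P.rot ^ a) y = w := by
      obtain ⟨a, -, ha⟩ := P.exists_pow_rot_eq hwy.symm (h.degree_le _)
      exact ⟨a, ha⟩
    classical
    have ha := Nat.find_spec hex
    have hmin : ∀ i < Nat.find hex, (P.rot ^ i) y ≠ w := fun i hi => Nat.find_min hex hi
    generalize Nat.find hex = a at ha hmin
    -- An unbounded dart on the way would be `y` again, which contradicts the minimality of `a`.
    have hbd : ∀ i, 0 < i → i ≤ a → (P.rot ^ i) y ∈ P.bounded := by
      intro i hi hia
      by_contra hiu
      have hiy := h.unbounded_unique hiu hyu (P.rot_pow_fst _ _)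
      apply hmin (a - i) (by omega)
      conv_lhs => rw [← hiy]
      rw [← Equiv.Perm.mul_apply, ← pow_add, Nat.sub_add_cancel hia, ha]
    have ha0 : 0 < a := by
      rcases Nat.eq_zero_or_pos a with h0 | h0
      · subst h0
        exact absurd hw (by rw [← ha]; exact hyu)
      · exact h0
    have hall : ∀ i, i < a → F ((P.rot ^ (i + 1)) y) = F (P.rot y) := by
      intro i hi
      induction i with
      | zero => simp
      | succ i ih =>
        rw [← ih (by omega)]
        have := hF _ (hbd (i + 1) (by omega) (by omega)) (by
          rw [← Equiv.Perm.mul_apply, ← pow_succ']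
          exact hbd (i + 1 + 1) (by omega) (by omega))
        rw [← Equiv.Perm.mul_apply, ← pow_succ'] at this
        exact this.symm
    have := hall (a - 1) (by omega)
    rwa [Nat.sub_add_cancel ha0, ha] at this
  rw [key z hz hy.symm, key z' hz' (hzz'.symm.trans hy.symm)]

/-- Any two bounded faces are connected by a sequence of bounded faces sharing edges. -/
theorem bounded_induction {p : G.Dart → Prop} {d₀ : G.Dart} (hd₀ : d₀ ∈ P.bounded) (hp : p d₀)
    (hnext : ∀ d ∈ P.bounded, p d → p (P.next d))
    (hsymm : ∀ d ∈ P.bounded, d.symm ∈ P.bounded → p d → p d.symm) {d : G.Dart}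
    (hd : d ∈ P.bounded) : p d := by
  have hpow : ∀ i d, d ∈ P.bounded → p d → p ((P.next ^ i) d) := by
    intro i d hd hpd
    induction i with
    | zero => exact hpd
    | succ i ih =>
      rw [pow_succ', Equiv.Perm.mul_apply]
      exact hnext _ (P.next_pow_mem_bounded hd i) ih
  have hprev : ∀ d ∈ P.bounded, p (P.next d) → p d := by
    intro d hd hpd
    have h1 := hpow (r - 1) _ ((P.bounded_next _).2 hd) hpd
    have h2 := h.three_le
    rwa [← Equiv.Perm.mul_apply, ← pow_succ, Nat.sub_add_cancel (by omega), h.next_pow d hd] at h1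
  -- `z` and `rot z` belong to the faces on the two sides of the edge of `z`, because `rot z = next
  -- z.symm`.
  have hrot : ∀ z ∈ P.bounded, P.rot z ∈ P.bounded → (p z ↔ p (P.rot z)) := by
    intro z hz hz'
    rw [← P.next_symm] at hz' ⊢
    rw [P.bounded_next] at hz'
    exact ⟨fun hpz => hnext _ hz' (hsymm _ hz hz' hpz), fun hpz => by
      simpa using hsymm _ hz' (by simpa using hz) (hprev _ hz' hpz)⟩
  have hvert : ∀ z z' : G.Dart, z ∈ P.bounded → z' ∈ P.bounded → z.fst = z'.fst → p z → p z' :=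
    fun z z' hz hz' hzz' =>
      (h.eq_of_fst_eq (F := p) (fun z hz hz' => propext (hrot z hz hz')) hz hz' hzz').mp
  have hwalk : ∀ v w : V, G.Walk v w → (∀ z ∈ P.bounded, z.fst = v → p z) →
      ∀ z ∈ P.bounded, z.fst = w → p z := by
    intro v w W
    induction W with
    | nil => exact fun h => h
    | @cons a b c hab W ih =>
      intro hv
      apply ih
      intro z hz hzb
      let e : G.Dart := ⟨(a, b), hab⟩
      rcases h.bounded_or_symm_bounded e with he | he
      · exact hvert (P.next e) z ((P.bounded_next _).2 he) hz ((P.next_fst e).trans hzb.symm)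
          (hnext e he (hv e he rfl))
      · have he' : P.next e.symm ∈ P.bounded := (P.bounded_next _).2 he
        exact hvert e.symm z he hz hzb.symm (hprev _ he (hv _ he' (P.next_fst e.symm)))
  obtain ⟨W⟩ := h.connected.preconnected d₀.fst d.fst
  exact hwalk _ _ W (fun z hz hzv => hvert d₀ z hd₀ hz hzv.symm hp) d hd rfl

open Classical in
/-- An edge between two bounded faces separates them: there is a function on the faces that
changes only across this edge. -/
theorem exists_side {x : G.Dart} (hx : x ∈ P.bounded) (hx' : x.symm ∈ P.bounded) :
    ∃ σ : G.Dart → ZMod 2, σ x ≠ σ x.symm ∧ (∀ d ∈ P.bounded, σ (P.next d) = σ d) ∧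
      ∀ d : G.Dart, d ≠ x → d ≠ x.symm → σ d.symm = σ d := by
  obtain ⟨y, hy, hyu⟩ := h.exists_unbounded x.fst
  obtain ⟨y', hy', hyu'⟩ := h.exists_unbounded x.snd
  have hrx : P.rot x ∈ P.bounded := by rw [← P.next_symm, P.bounded_next]; exact hx'
  have hrx' : P.rot x.symm ∈ P.bounded := by
    rw [← P.next_symm, P.bounded_next, SimpleGraph.Dart.symm_symm]; exact hx
  -- The two arcs form a dual curve: from the face of `x.symm` around `x.fst` to the outside, then
  -- around `x.snd` back to that face. The unbounded corners do not count and the other two cancel,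
  -- so the combined cochain vanishes on cycles.
  obtain ⟨A, c, a1, a2, a3, a4, a5, a6, -, a8, a9, a10⟩ := P.exists_arc (a := P.rot x) (b := y)
    (fun he => hyu (he ▸ hrx)) (by rw [P.rot_fst, hy]) (h.finite_neighborSet _)
  obtain ⟨A', c', b1, b2, b3, b4, b5, b6, b7, b8, b9, b10⟩ := P.exists_arc (a := y') (b := x.symm)
    (fun he => hyu' (he ▸ hx')) hy' (h.finite_neighborSet _)
  rw [P.rot_fst] at a3 a8 a9
  rw [hy'] at b3 b8 b9
  have hxA : x ∉ A := fun hxA => a6 x hxA rfl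
  have hne : x.symm ≠ x := x.symm_ne
  have hrxx : P.rot x ≠ x := fun he => hxA (he ▸ a1)
  have hrxx' : P.rot x.symm ≠ x.symm := by
    intro he
    have := (P.rot_cyclic x.symm y' hy'.symm).eq_of_left he
    exact hyu' (this ▸ hx')
  obtain ⟨χ, hχ0, hχ⟩ := SimpleGraph.exists_potential h.connected (fun e => c e + c' e) (by
    intro v p hp
    obtain ⟨S, -, hSb, hSn, hSp⟩ := P.jordan v p hp
    rw [List.sum_map_add, a10 v p hp S hSn hSp, b10 v p hp S hSn hSp,
      if_neg fun hs => hyu (hSb hs), if_neg fun hs => hyu' (hSb hs), add_zero, zero_add,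
      ← P.next_symm, hSn, CharTwo.add_self_eq_zero]) x.fst
  have hχ1 : χ x.snd = 0 := by
    have h1 := hχ _ _ x.adj
    rw [hχ0, zero_add, show s(x.fst, x.snd) = x.edge from rfl, a8 x rfl, if_neg hxA,
      ← SimpleGraph.Dart.edge_symm, b8 x.symm rfl, if_neg b2, add_zero] at h1
    exact h1
  have hu : ∀ z : G.Dart, z.fst = x.fst → z ≠ x → z.snd ≠ x.snd ∧
      χ z.snd = if z ∈ A then 1 else 0 := by
    intro z hz hzx
    have hzs : z.snd ≠ x.snd := fun he => hzx (SimpleGraph.Dart.ext _ _ (Prod.ext hz he))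
    refine ⟨hzs, ?_⟩
    have h1 := hχ _ _ z.adj
    rw [b9 _ (by
      rw [Sym2.mem_iff]
      rintro (h1 | h1)
      · rw [hz] at h1; exact x.adj.ne' h1
      · exact hzs h1.symm), show s(z.fst, z.snd) = z.edge from rfl, a8 z hz, hz, hχ0, zero_add,
      add_zero] at h1
    exact h1
  have hv : ∀ z : G.Dart, z.fst = x.snd → z ≠ x.symm → z.snd ≠ x.fst ∧
      χ z.snd = if z ∈ A' then 1 else 0 := by
    intro z hz hzx
    have hzs : z.snd ≠ x.fst := fun he => hzx (SimpleGraph.Dart.ext _ _ (Prod.ext hz he))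
    refine ⟨hzs, ?_⟩
    have h1 := hχ _ _ z.adj
    rw [a9 _ (by
      rw [Sym2.mem_iff]
      rintro (h1 | h1)
      · rw [hz] at h1; exact x.adj.ne h1
      · exact hzs h1.symm), show s(z.fst, z.snd) = z.edge from rfl, b8 z hz, hz, hχ1, zero_add,
      zero_add] at h1
    exact h1
  -- The potential is 0 at both ends of `x` and says nothing about sides there. A dart is therefore
  -- coloured by an end that is not an end of `x`; only `x` and `x.symm` have no such end, and they
  -- are coloured by hand.
  let σ : G.Dart → ZMod 2 := fun d => if d = x then 0 else if d = x.symm then 1 else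
    if d.fst = x.fst ∨ d.fst = x.snd then χ d.snd else χ d.fst
  have σx : σ x = 0 := if_pos rfl
  have σx' : σ x.symm = 1 := (if_neg hne).trans (if_pos rfl)
  have σ1 : ∀ d, d ≠ x → d ≠ x.symm → d.fst = x.fst ∨ d.fst = x.snd → σ d = χ d.snd := by
    intro d h1 h2 h3
    simp only [σ]; rw [if_neg h1, if_neg h2, if_pos h3]
  have σ2 : ∀ d, d ≠ x → d ≠ x.symm → ¬ (d.fst = x.fst ∨ d.fst = x.snd) → σ d = χ d.fst := by
    intro d h1 h2 h3
    simp only [σ]; rw [if_neg h1, if_neg h2, if_neg h3]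
  have hin : ∀ a b, G.Adj a b → ¬ (a = x.fst ∨ a = x.snd) → ¬ (b = x.fst ∨ b = x.snd) →
      χ a = χ b := by
    intro a b hab ha hb
    push Not at ha hb
    have h1 := hχ a b hab
    rw [a9 _ (by simp [ha.1.symm, hb.1.symm]), b9 _ (by simp [ha.2.symm, hb.2.symm]),
      add_zero] at h1
    exact CharTwo.add_eq_zero.1 h1
  have hsymm : ∀ d : G.Dart, d ≠ x → d ≠ x.symm → σ d.symm = σ d := by
    intro d h1 h2
    have h1' : d.symm ≠ x.symm := fun he => h1 (SimpleGraph.Dart.symm_involutive.injective he)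
    have h2' : d.symm ≠ x := fun he => h2 (by rw [← he, SimpleGraph.Dart.symm_symm])
    by_cases h3 : d.fst = x.fst ∨ d.fst = x.snd
    · rw [σ1 d h1 h2 h3, σ2 _ h2' h1']
      · rfl
      · change ¬ (d.snd = x.fst ∨ d.snd = x.snd)
        rintro (h4 | h4) <;> rcases h3 with h3 | h3
        · exact d.adj.ne (h3.trans h4.symm)
        · exact (hv d h3 h2).1 h4
        · exact (hu d h3 h1).1 h4
        · exact d.adj.ne (h3.trans h4.symm)
    · by_cases h4 : d.snd = x.fst ∨ d.snd = x.snd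
      · rw [σ2 d h1 h2 h3, σ1 d.symm h2' h1' h4]; rfl
      · rw [σ2 d h1 h2 h3, σ2 d.symm h2' h1' h4]
        exact (hin _ _ d.adj h3 h4).symm
  refine ⟨σ, by rw [σx, σx']; exact zero_ne_one, ?_, hsymm⟩
  intro d hd
  obtain ⟨z, rfl⟩ : ∃ z : G.Dart, d = z.symm := ⟨d.symm, by simp⟩
  have hrz : P.rot z ∈ P.bounded := by rw [← P.next_symm, P.bounded_next]; exact hd
  rw [P.next_symm]
  by_cases hzu : z.fst = x.fst
  · have hzx' : z ≠ x.symm := fun he => x.adj.ne (hzu.symm.trans (he ▸ rfl))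
    have hrzu : (P.rot z).fst = x.fst := (P.rot_fst z).trans hzu
    have hrzx' : P.rot z ≠ x.symm := fun he => x.adj.ne (hrzu.symm.trans (he ▸ rfl))
    have hry : P.rot z ≠ y := fun he => hyu (he ▸ hrz)
    by_cases hzx : z = x
    · subst hzx
      rw [σx', σ1 _ hrxx hrzx' (Or.inl hrzu), (hu _ hrzu hrxx).2, if_pos a1]
    · rw [hsymm z hzx hzx', σ1 z hzx hzx' (Or.inl hzu), (hu z hzu hzx).2]
      by_cases hrzx : P.rot z = x
      · rw [hrzx, σx, if_neg fun hzA => hxA (hrzx ▸ a4 z hzA hry)]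
      · rw [σ1 _ hrzx hrzx' (Or.inl hrzu), (hu _ hrzu hrzx).2]
        have : P.rot z ∈ A ↔ z ∈ A :=
          ⟨fun hA => a5 z hA fun he => hzx (P.rot.injective he), fun hA => a4 z hA hry⟩
        simp only [this]
  · by_cases hzv : z.fst = x.snd
    · have hzx : z ≠ x := fun he => x.adj.ne (he ▸ hzv)
      have hrzv : (P.rot z).fst = x.snd := (P.rot_fst z).trans hzv
      have hrzx : P.rot z ≠ x := fun he => x.adj.ne (he ▸ hrzv)
      have hry : P.rot z ≠ y' := fun he => hyu' (he ▸ hrz)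
      by_cases hzx' : z = x.symm
      · subst hzx'
        rw [SimpleGraph.Dart.symm_symm, σx, σ1 _ hrzx hrxx' (Or.inr hrzv), (hv _ hrzv hrxx').2,
          if_neg fun hA => b2 (b5 _ hA hry)]
      · rw [hsymm z hzx hzx', σ1 z hzx hzx' (Or.inr hzv), (hv z hzv hzx').2]
        by_cases hrzx' : P.rot z = x.symm
        · rw [hrzx', σx', if_pos (b7 z hrzx')]
        · rw [σ1 _ hrzx hrzx' (Or.inr hrzv), (hv _ hrzv hrzx').2]
          have : P.rot z ∈ A' ↔ z ∈ A' := ⟨fun hA => b5 z hA hry, fun hA => b4 z hA hrzx'⟩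
          simp only [this]
    · have hzx : z ≠ x := fun he => hzu (he ▸ rfl)
      have hzx' : z ≠ x.symm := fun he => hzv (he ▸ rfl)
      have hrzx : P.rot z ≠ x := fun he => hzu (by rw [← P.rot_fst, he])
      have hrzx' : P.rot z ≠ x.symm := fun he => hzv (by rw [← P.rot_fst, he]; rfl)
      have hnot : ¬ (z.fst = x.fst ∨ z.fst = x.snd) := by rintro (h1 | h1); exacts [hzu h1, hzv h1]
      rw [hsymm z hzx hzx', σ2 z hzx hzx' hnot, σ2 _ hrzx hrzx' (by rw [P.rot_fst]; exact hnot),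
        P.rot_fst]

end IsOuterplanarRealization

/-! ## Holonomy -/

variable (P : PlaneMap G)

/-- `Holonomy P ρ τ a b m n`: a path from `a` to `b` through the bounded faces that crosses `n`
edges and has holonomy `m`, where `ρ` is the holonomy of a step along a face and `τ` that of
crossing an edge. -/
inductive Holonomy {Γ : Type*} [Monoid Γ] (ρ τ : Γ) (a : G.Dart) : G.Dart → Γ → ℕ → Prop
  | refl : Holonomy ρ τ a a 1 0
  | next {b : G.Dart} {m : Γ} {n : ℕ} : Holonomy ρ τ a b m n → b ∈ P.bounded →
      Holonomy ρ τ a (P.next b) (m * ρ) n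
  | cross {b : G.Dart} {m : Γ} {n : ℕ} : Holonomy ρ τ a b m n → b ∈ P.bounded →
      b.symm ∈ P.bounded → Holonomy ρ τ a b.symm (m * τ) (n + 1)

namespace Holonomy

variable {P} {Γ : Type*} [Monoid Γ] {ρ τ : Γ}

theorem trans {a b c : G.Dart} {m m' : Γ} {n n' : ℕ} (h : P.Holonomy ρ τ a b m n)
    (h' : P.Holonomy ρ τ b c m' n') : P.Holonomy ρ τ a c (m * m') (n + n') := by
  induction h' with
  | refl => simpa using h
  | next _ hb ih => rw [← mul_assoc]; exact ih.next hb
  | cross _ hb hb' ih => rw [← mul_assoc, ← add_assoc]; exact ih.cross hb hb'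

theorem next_pow {a : G.Dart} (ha : a ∈ P.bounded) (i : ℕ) :
    Holonomy P ρ τ a ((P.next ^ i) a) (ρ ^ i) 0 := by
  induction i with
  | zero => rw [pow_zero, pow_zero]; exact .refl
  | succ i ih =>
    rw [pow_succ', Equiv.Perm.mul_apply, pow_succ]
    exact ih.next (P.next_pow_mem_bounded ha i)

theorem eq_next_pow {a b : G.Dart} {m : Γ} {n : ℕ} (h : P.Holonomy ρ τ a b m n) (hn : n = 0) :
    ∃ i, b = (P.next ^ i) a ∧ m = ρ ^ i := by
  induction h with
  | refl => exact ⟨0, rfl, (pow_zero _).symm⟩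
  | next _ _ ih =>
    obtain ⟨i, rfl, rfl⟩ := ih hn
    exact ⟨i + 1, by rw [pow_succ', Equiv.Perm.mul_apply], (pow_succ _ _).symm⟩
  | cross => omega

theorem exists_first_cross {a b : G.Dart} {m : Γ} {n : ℕ} (h : P.Holonomy ρ τ a b m n)
    (hn : n ≠ 0) :
    ∃ i m', ((P.next ^ i) a).symm ∈ P.bounded ∧ m = ρ ^ i * (τ * m') ∧
      P.Holonomy ρ τ ((P.next ^ i) a).symm b m' (n - 1) := by
  induction h with
  | refl => exact absurd rfl hn
  | next _ hb ih =>
    obtain ⟨i, m', h1, h2, h3⟩ := ih hn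
    exact ⟨i, m' * ρ, h1, by rw [h2]; simp only [mul_assoc], h3.next hb⟩
  | @cross b m n h hb hb' ih =>
    by_cases hn' : n = 0
    · obtain ⟨i, rfl, rfl⟩ := h.eq_next_pow hn'
      refine ⟨i, 1, hb', by rw [mul_one], ?_⟩
      rw [hn']
      exact .refl
    · obtain ⟨i, m', h1, h2, h3⟩ := ih hn'
      refine ⟨i, m' * τ, h1, by rw [h2]; simp only [mul_assoc], ?_⟩
      have := h3.cross hb hb'
      rwa [Nat.sub_add_cancel (Nat.one_le_iff_ne_zero.2 hn')] at this

/-- A path starting on one side of an edge either ends on this side, or there is a first time when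
it crosses this edge. -/
theorem stays_or_crosses {x b : G.Dart} {m : Γ} {n : ℕ} {σ : G.Dart → ZMod 2}
    (hσ : σ x ≠ σ x.symm) (hnext : ∀ d ∈ P.bounded, σ (P.next d) = σ d)
    (hsymm : ∀ d : G.Dart, d ≠ x → d ≠ x.symm → σ d.symm = σ d)
    (h : P.Holonomy ρ τ x.symm b m n) :
    σ b = σ x.symm ∨ ∃ m₁ n₁ m₂ n₂, P.Holonomy ρ τ x.symm x.symm m₁ n₁ ∧
      P.Holonomy ρ τ x b m₂ n₂ ∧ m = m₁ * (τ * m₂) ∧ n = n₁ + n₂ + 1 := by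
  induction h with
  | refl => exact Or.inl rfl
  | next _ hb ih =>
    rcases ih with ih | ⟨m₁, n₁, m₂, n₂, h1, h2, rfl, rfl⟩
    · exact Or.inl ((hnext _ hb).trans ih)
    · exact Or.inr ⟨m₁, n₁, m₂ * ρ, n₂, h1, h2.next hb, by simp only [mul_assoc], rfl⟩
  | @cross b m n h hb hb' ih =>
    rcases ih with ih | ⟨m₁, n₁, m₂, n₂, h1, h2, rfl, rfl⟩
    · by_cases hbx : b = x
      · exact absurd (hbx ▸ ih) hσ
      by_cases hbx' : b = x.symm
      · subst hbx'
        refine Or.inr ⟨m, n, 1, 0, h, ?_, by rw [mul_one], by omega⟩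
        rw [SimpleGraph.Dart.symm_symm]
        exact .refl
      · exact Or.inl ((hsymm _ hbx hbx').trans ih)
    · exact Or.inr ⟨m₁, n₁, m₂ * τ, n₂ + 1, h1, h2.cross hb hb', by simp only [mul_assoc], by omega⟩

end Holonomy

namespace IsOuterplanarRealization

variable {P} {r q : ℕ} (h : P.IsOuterplanarRealization r q)
include h

theorem dvd_of_next_pow {d : G.Dart} (hd : d ∈ P.bounded) {i : ℕ} (hi : (P.next ^ i) d = d) :
    r ∣ i := by
  have hr := h.three_le
  have hmul : ∀ k, (P.next ^ (r * k)) d = d := fun k => by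
    rw [pow_mul]
    exact Equiv.Perm.pow_apply_eq_self_of_apply_eq_self (h.next_pow d hd) k
  have h1 : (P.next ^ (i % r)) d = d := by
    conv_rhs => rw [← hi, ← Nat.mod_add_div i r, pow_add, Equiv.Perm.mul_apply, hmul]
  have h2 := h.injOn d hd (x₁ := i % r) (x₂ := 0) (Nat.mod_lt _ (by omega))
    (show 0 < r by omega) (by simp only [h1]; rfl)
  exact Nat.dvd_of_mod_eq_zero h2

/-- A closed path in a tree backtracks. The first edge crossed must be crossed back; the excursion
beyond it is a closed path with fewer crossings, hence trivial, and the two crossings cancel by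
`hτ`. What remains is again a shorter closed path. -/
theorem holonomy_eq_one {Γ : Type*} [Monoid Γ] {ρ τ : Γ} (hρ : ρ ^ r = 1) (hτ : τ * τ = 1)
    (n : ℕ) : ∀ {a : G.Dart} {m : Γ}, a ∈ P.bounded → P.Holonomy ρ τ a a m n → m = 1 := by
  induction n using Nat.strong_induction_on with
  | _ n ih =>
    intro a m ha H
    by_cases hn : n = 0
    · obtain ⟨i, hi, rfl⟩ := H.eq_next_pow hn
      obtain ⟨k, rfl⟩ := h.dvd_of_next_pow ha hi.symm
      rw [pow_mul, hρ, one_pow]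
    · obtain ⟨i, m', h1, rfl, h2⟩ := H.exists_first_cross hn
      have hx := P.next_pow_mem_bounded ha i
      obtain ⟨σ, hσ, hnext, hsymm⟩ := h.exists_side hx h1
      have hσa : ∀ j, σ ((P.next ^ j) a) = σ a := fun j => by
        induction j with
        | zero => rfl
        | succ j ihj =>
          rw [pow_succ', Equiv.Perm.mul_apply, hnext _ (P.next_pow_mem_bounded ha j), ihj]
      rcases h2.stays_or_crosses hσ hnext hsymm with h3 | ⟨m₁, n₁, m₂, n₂, h3, h4, rfl, h5⟩
      · rw [hσa] at hσ
        exact absurd h3 hσ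
      · rw [ih n₁ (by omega) h1 h3, one_mul, ← mul_assoc τ, hτ, one_mul]
        exact ih (0 + n₂) (by omega) ha ((Holonomy.next_pow ha i).trans h4)

theorem exists_holonomy {Γ : Type*} [Monoid Γ] (ρ τ : Γ) {a b : G.Dart} (ha : a ∈ P.bounded)
    (hb : b ∈ P.bounded) : ∃ m n, P.Holonomy ρ τ a b m n :=
  h.bounded_induction (p := fun b => ∃ m n, P.Holonomy ρ τ a b m n) ha ⟨1, 0, .refl⟩
    (fun _ hd ⟨_, _, H⟩ => ⟨_, _, H.next hd⟩) (fun _ hd hd' ⟨_, _, H⟩ => ⟨_, _, H.cross hd hd'⟩) hb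

/-- A local system on the bounded faces with values in a monoid is trivial. -/
theorem exists_trivialization {Γ : Type*} [Monoid Γ] {ρ τ : Γ} (hρ : ρ ^ r = 1)
    (hτ : τ * τ = 1) {a : G.Dart} (ha : a ∈ P.bounded) :
    ∃ M : G.Dart → Γ, (∀ d ∈ P.bounded, ∃ n, P.Holonomy ρ τ a d (M d) n) ∧
      (∀ d ∈ P.bounded, M (P.next d) = M d * ρ) ∧
      ∀ d ∈ P.bounded, d.symm ∈ P.bounded → M d.symm = M d * τ := by
  -- `Γ` need not have inverses; the holonomy of a path back to `a` takes their place.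
  have huniq : ∀ {b : G.Dart} {m m' : Γ} {n n' : ℕ}, b ∈ P.bounded → P.Holonomy ρ τ a b m n →
      P.Holonomy ρ τ a b m' n' → m = m' := by
    intro b m m' n n' hb H H'
    obtain ⟨k, l, K⟩ := h.exists_holonomy ρ τ hb ha
    have h1 := h.holonomy_eq_one hρ hτ _ ha (H.trans K)
    have h2 := h.holonomy_eq_one hρ hτ _ hb (K.trans H')
    calc m = m * (k * m') := by rw [h2, mul_one]
      _ = m' := by rw [← mul_assoc, h1, one_mul]
  choose! M hM using fun (d : G.Dart) (hd : d ∈ P.bounded) => h.exists_holonomy ρ τ ha hd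
  refine ⟨M, hM, fun d hd => ?_, fun d hd hd' => ?_⟩
  · obtain ⟨n, hn⟩ := hM d hd
    have hd' := (P.bounded_next d).2 hd
    obtain ⟨n', hn'⟩ := hM _ hd'
    exact huniq hd' hn' (hn.next hd)
  · obtain ⟨n, hn⟩ := hM d hd
    obtain ⟨n', hn'⟩ := hM _ hd'
    exact huniq hd' hn' (hn.cross hd hd')

end IsOuterplanarRealization

/-! ## Chains of faces -/

/-- `FaceChain P r a d s t`: a chain of bounded faces without backtracking, beginning with the
face of `a`. It enters its last face through the edge of `d`, and its last `s` faces have the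
terminal vertex of `d` in common, its last `t` faces the initial vertex of `d`. -/
inductive FaceChain (r : ℕ) (a : G.Dart) : G.Dart → ℕ → ℕ → Prop
  | single : a ∈ P.bounded → FaceChain r a a 1 1
  | step {d : G.Dart} {s t : ℕ} (i : ℕ) : FaceChain r a d s t → 1 ≤ i → i < r →
      ((P.next ^ i) d).symm ∈ P.bounded → FaceChain r a ((P.next ^ i) d).symm
        (if i = 1 then s + 1 else 2) (if i + 1 = r then t + 1 else 2)

namespace FaceChain

variable {P} {r : ℕ} {a d : G.Dart} {s t : ℕ}

theorem mem_bounded (H : P.FaceChain r a d s t) : d ∈ P.bounded := by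
  cases H with
  | single h => exact h
  | step _ _ _ _ h => exact h

/-- The faces counted by `s` occupy successive bounded corners at one end of `d`, and likewise for
`t` at the other end. With `q` of them, all corners at that vertex would be bounded. -/
theorem lt_degree {q : ℕ} (h : P.IsOuterplanarRealization r q) (H : P.FaceChain r a d s t) :
    s < q ∧ t < q := by
  have key : (∀ j < s, (P.rot.symm ^ j) (P.next d) ∈ P.bounded) ∧
      ∀ j < t, (P.rot ^ j) d ∈ P.bounded := by
    induction H with
    | single ha =>
      constructor <;> intro j hj <;> obtain rfl : j = 0 := by omega
      · exact (P.bounded_next _).2 ha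
      · exact ha
    | @step d s t i H h1 hi hb ih =>
      have hd := H.mem_bounded
      have hnd : P.rot.symm (P.next ((P.next ^ i) d).symm) = (P.next ^ i) d := by
        rw [P.next_symm, Equiv.symm_apply_apply]
      have hrd : P.rot ((P.next ^ i) d).symm = (P.next ^ (i + 1)) d := by
        rw [← P.next_symm, SimpleGraph.Dart.symm_symm, pow_succ', Equiv.Perm.mul_apply]
      constructor
      · intro j hj
        rcases j with _ | j
        · exact (P.bounded_next _).2 hb
        · rw [pow_succ, Equiv.Perm.mul_apply, hnd]
          split_ifs at hj with h'
          · subst h'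
            exact ih.1 j (by omega)
          · obtain rfl : j = 0 := by omega
            exact P.next_pow_mem_bounded hd i
      · intro j hj
        rcases j with _ | j
        · exact hb
        · rw [pow_succ, Equiv.Perm.mul_apply, hrd]
          split_ifs at hj with h'
          · rw [h', h.next_pow _ hd]
            exact ih.2 j (by omega)
          · obtain rfl : j = 0 := by omega
            exact P.next_pow_mem_bounded hd _
  constructor
  · by_contra! hq
    obtain ⟨y, hy, hyu⟩ := h.exists_unbounded (P.next d).fst
    obtain ⟨k, hk, hky⟩ := P.exists_pow_rot_eq hy (h.degree_le _)
    apply hyu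
    have := key.1 k (by omega)
    rw [← hky] at this
    have h2 : (P.rot.symm ^ k) ((P.rot ^ k) y) = y := by
      change (P.rot⁻¹ ^ k) ((P.rot ^ k) y) = y
      rw [← Equiv.Perm.mul_apply, inv_pow, inv_mul_cancel, Equiv.Perm.one_apply]
    rwa [h2] at this
  · by_contra! hq
    obtain ⟨y, hy, hyu⟩ := h.exists_unbounded d.fst
    obtain ⟨k, hk, hky⟩ := P.exists_pow_rot_eq hy.symm (h.degree_le _)
    exact hyu (hky ▸ key.2 k (by omega))

end FaceChain

namespace IsOuterplanarRealization

variable {P} {r q : ℕ} (h : P.IsOuterplanarRealization r q)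
include h

theorem exists_next_pow_eq {d d' : G.Dart} (hd : d ∈ P.bounded) (hdd' : P.next.SameCycle d d') :
    ∃ i < r, (P.next ^ i) d = d' := by
  obtain ⟨z, hz⟩ := hdd'
  have hr : (0 : ℤ) < r := by have := h.three_le; omega
  have hmod := Int.emod_nonneg z hr.ne'
  have hlt := Int.emod_lt_of_pos z hr
  refine ⟨(z % r).toNat, by omega, ?_⟩
  have h3 : ((P.next ^ r) ^ (z / r)) d = d :=
    Equiv.Perm.zpow_apply_eq_self_of_apply_eq_self (h.next_pow d hd) _
  rw [← Int.emod_add_mul_ediv z r, zpow_add, Equiv.Perm.mul_apply, zpow_mul, zpow_natCast,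
    h3] at hz
  rw [← hz, ← zpow_natCast, Int.toNat_of_nonneg hmod]

theorem exists_faceChain {d₀ d : G.Dart} (hd₀ : d₀ ∈ P.bounded) (hd : d ∈ P.bounded) :
    ∃ a d' s t, P.FaceChain r a d' s t ∧ P.next.SameCycle d₀ a ∧ P.next.SameCycle d' d := by
  have hr := h.three_le
  refine h.bounded_induction (p := fun d => ∃ a d' s t, P.FaceChain r a d' s t ∧
    P.next.SameCycle d₀ a ∧ P.next.SameCycle d' d) hd₀ ⟨d₀, d₀, 1, 1, .single hd₀, .refl _ _,
    .refl _ _⟩ ?_ ?_ hd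
  · rintro d hd ⟨a, d', s, t, H, h1, h2⟩
    exact ⟨a, d', s, t, H, h1, h2.trans ⟨1, rfl⟩⟩
  · rintro d hd hd' ⟨a, d', s, t, H, h1, h2⟩
    obtain ⟨i, hi, rfl⟩ := h.exists_next_pow_eq H.mem_bounded h2
    -- For `i = 0` the chain would cross back through its entering dart. If it is a single face, its
    -- starting dart is moved on by one, which turns the exit into number `r - 1`; otherwise its
    -- last step is dropped.
    rcases Nat.eq_zero_or_pos i with rfl | hi0
    · cases H with
      | single ha =>
        have ha' := (P.bounded_next a).2 ha
        have hpow : (P.next ^ (r - 1)) (P.next a) = a := by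
          rw [← Equiv.Perm.mul_apply, ← pow_succ, Nat.sub_add_cancel (by omega), h.next_pow a ha]
        have H := FaceChain.step (r - 1) (FaceChain.single (r := r) ha') (by omega) (by omega)
          (by rw [hpow]; exact hd')
        rw [hpow] at H
        exact ⟨_, _, _, _, H, h1.trans ⟨1, rfl⟩, .refl _ _⟩
      | @step d' s' t' j H hj hj' hb =>
        refine ⟨a, d', s', t', H, h1, ⟨j, ?_⟩⟩
        simp
    · exact ⟨_, _, _, _, H.step i hi0 hi hd', h1, .refl _ _⟩

end IsOuterplanarRealization

end PlaneMap

/-! ## The regular partition -/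

/-- Seen from the point of the unit circle at angle `0`, the arc from `β` to `2π - β` lies in the
angle spanned by the points at `±β`, beyond their chord. Hence its points are affine combinations of
these three, with weights `a`, `b` and `-c`. Every family of functionals affine in `(cos φ, sin φ)`
is thereby controlled by its members at `0` and `±β`. -/
theorem nonneg_of_trig_polygon {β φ : ℝ} (h0 : 0 < β) (hπ : β < Real.pi) (h1 : β ≤ φ)
    (h2 : φ ≤ 2 * Real.pi - β) : ∃ a b c : ℝ, 0 ≤ a ∧ 0 ≤ b ∧ 0 ≤ c ∧ a + b = 1 + c ∧
      Real.cos φ = (a + b) * Real.cos β - c ∧ Real.sin φ = (a - b) * Real.sin β := by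
  obtain ⟨f, rfl⟩ : ∃ f, φ = 2 * f := ⟨φ / 2, by ring⟩
  obtain ⟨b, rfl⟩ : ∃ b, β = 2 * b := ⟨β / 2, by ring⟩
  have hb : 0 < Real.sin b := Real.sin_pos_of_pos_of_lt_pi (by linarith) (by linarith)
  have hb' : 0 < Real.cos b := Real.cos_pos_of_mem_Ioo ⟨by linarith, by linarith⟩
  have hf : 0 < Real.sin f := Real.sin_pos_of_pos_of_lt_pi (by linarith) (by linarith)
  have e1 : 0 ≤ Real.sin (f - b) := Real.sin_nonneg_of_nonneg_of_le_pi (by linarith) (by linarith)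
  have e2 : 0 ≤ Real.sin (f + b) := Real.sin_nonneg_of_nonneg_of_le_pi (by linarith) (by linarith)
  rw [Real.sin_sub] at e1
  rw [Real.sin_add] at e2
  have sf := Real.sin_sq_add_cos_sq f
  have sb := Real.sin_sq_add_cos_sq b
  set x := Real.sin f
  set y := Real.cos f
  set z := Real.sin b
  set w := Real.cos b
  refine ⟨x * (x * w + y * z) / (2 * z ^ 2 * w), x * (x * w - y * z) / (2 * z ^ 2 * w),
    x ^ 2 / z ^ 2 - 1, by positivity, by positivity, ?_, ?_, ?_, ?_⟩
  -- `sin (f - b) * sin (f + b) = sin f ^ 2 - sin b ^ 2`.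
  · rw [sub_nonneg, one_le_div (by positivity)]
    nlinarith [mul_nonneg e1 e2]
  · field_simp; ring
  · rw [Real.cos_two_mul', Real.cos_two_mul']
    change y ^ 2 - x ^ 2 = _ * (w ^ 2 - z ^ 2) - _
    have hy : y ^ 2 = 1 - x ^ 2 := by linarith
    have hw : w ^ 2 = 1 - z ^ 2 := by linarith
    rw [hy, hw]
    field_simp
    ring
  · rw [Real.sin_two_mul, Real.sin_two_mul]
    change 2 * x * y = _ * (2 * z * w)
    field_simp
    ring

namespace RegularPartition

open Real Matrix

variable (r q : ℕ)

/-- The vertices of the base face, indexed by the integers. -/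
noncomputable def corner (j : ℤ) : Fin 3 → ℝ :=
  ![cos ((2 * j + 1) * (π / r)), sin ((2 * j + 1) * (π / r)), height r q]

theorem baseVertex_eq_corner (i : ℕ) : baseVertex r q i = corner r q i := by
  simp [baseVertex, corner]

/-- The rotation around the center of the base face. -/
noncomputable def rotationBy (φ : ℝ) : Matrix (Fin 3) (Fin 3) ℝ :=
  !![cos φ, -sin φ, 0; sin φ, cos φ, 0; 0, 0, 1]

/-- The rotation of the base face that moves every edge to the next one. -/
noncomputable def faceRotation : Matrix (Fin 3) (Fin 3) ℝ := rotationBy (2 * (π / r))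

/-- The half-turn around the midpoint of the edge from `corner r q (-1)` to `corner r q 0`. -/
noncomputable def halfTurn : Matrix (Fin 3) (Fin 3) ℝ :=
  !![1 - 2 * cos (π / q) ^ 2 / sin (π / r) ^ 2, 0, 2 * cos (π / q) * sin (π / q) / sin (π / r);
    0, -1, 0;
    curvature r q * (2 * cos (π / q) * sin (π / q) / sin (π / r)), 0,
      2 * cos (π / q) ^ 2 / sin (π / r) ^ 2 - 1]

/-- The reflection of the base face that fixes the edge from `corner r q (-1)` to
`corner r q 0`. -/
noncomputable def flip : Matrix (Fin 3) (Fin 3) ℝ := !![1, 0, 0; 0, -1, 0; 0, 0, 1]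

/-- The linear functional vanishing on the edge from `corner r q (j - 1)` to `corner r q j`. -/
noncomputable def edgeFun (j : ℤ) (y : Fin 3 → ℝ) : ℝ :=
  sin (π / r) * sin (π / q) * y 2 -
    cos (π / q) * (cos (2 * j * (π / r)) * y 0 + sin (2 * j * (π / r)) * y 1)

variable {r q}

theorem rotationBy_mul (φ ψ : ℝ) : rotationBy φ * rotationBy ψ = rotationBy (φ + ψ) := by
  ext i j
  fin_cases i <;> fin_cases j <;>
    simp [rotationBy, Matrix.mul_apply, Fin.sum_univ_three, cos_add, sin_add] <;> ring

theorem rotationBy_zero : rotationBy 0 = 1 := by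
  ext i j
  fin_cases i <;> fin_cases j <;> simp [rotationBy]

theorem rotationBy_two_pi : rotationBy (2 * π) = 1 := by
  ext i j
  fin_cases i <;> fin_cases j <;> simp [rotationBy]

theorem faceRotation_pow (i : ℕ) : faceRotation r ^ i = rotationBy (2 * i * (π / r)) := by
  induction i with
  | zero => simp [rotationBy_zero]
  | succ i ih =>
    rw [pow_succ, ih, faceRotation, rotationBy_mul]
    congr 1
    push_cast
    ring

theorem sin_pi_div_pos {n : ℕ} (hn : 2 ≤ n) : 0 < sin (π / n) := by
  have h : (2 : ℝ) ≤ n := by exact_mod_cast hn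
  apply sin_pos_of_pos_of_lt_pi (by positivity)
  rw [div_lt_iff₀ (by linarith)]
  nlinarith [pi_pos]

theorem cos_pi_div_pos {n : ℕ} (hn : 3 ≤ n) : 0 < cos (π / n) := by
  have h : (3 : ℝ) ≤ n := by exact_mod_cast hn
  have : 0 < π / n := by positivity
  apply cos_pos_of_mem_Ioo ⟨by linarith [pi_pos], ?_⟩
  rw [div_lt_div_iff₀ (by linarith) (by norm_num)]
  nlinarith [pi_pos]

theorem faceRotation_pow_self (hr : 3 ≤ r) : faceRotation r ^ r = 1 := by
  have : (r : ℝ) ≠ 0 := by norm_cast; omega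
  rw [faceRotation_pow, show 2 * (r : ℝ) * (π / r) = 2 * π by field_simp, rotationBy_two_pi]

theorem height_mul (hr : 3 ≤ r) (hq : 3 ≤ q) :
    height r q * (sin (π / r) * sin (π / q)) = cos (π / r) * cos (π / q) := by
  have h1 := (sin_pi_div_pos (n := r) (by omega)).ne'
  have h2 := (sin_pi_div_pos (n := q) (by omega)).ne'
  rw [height, cot_eq_cos_div_sin, cot_eq_cos_div_sin]
  field_simp

theorem height_pos (hr : 3 ≤ r) (hq : 3 ≤ q) : 0 < height r q := by
  have h1 := sin_pi_div_pos (n := r) (by omega)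
  have h2 := sin_pi_div_pos (n := q) (by omega)
  have h3 := cos_pi_div_pos hr
  have h4 := cos_pi_div_pos hq
  rw [height, cot_eq_cos_div_sin, cot_eq_cos_div_sin]
  positivity

theorem height_eq (hr : 3 ≤ r) (hq : 3 ≤ q) :
    height r q = cos (π / r) * cos (π / q) / (sin (π / r) * sin (π / q)) := by
  have h1 := (sin_pi_div_pos (n := r) (by omega)).ne'
  have h2 := (sin_pi_div_pos (n := q) (by omega)).ne'
  rw [eq_div_iff (by positivity), height_mul hr hq]

theorem rotationBy_mulVec_corner (i : ℕ) (j : ℤ) :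
    rotationBy (2 * i * (π / r)) *ᵥ corner r q j = corner r q (j + i) := by
  have h : (2 * ((j + i : ℤ) : ℝ) + 1) * (π / r) = 2 * i * (π / r) + (2 * j + 1) * (π / r) := by
    push_cast; ring
  ext k
  fin_cases k <;>
    simp [rotationBy, corner, Matrix.mulVec, dotProduct, Fin.sum_univ_three, -Int.cast_add, h,
      cos_add, sin_add]
  · ring

theorem faceRotation_pow_mulVec_corner (i : ℕ) (j : ℤ) :
    faceRotation r ^ i *ᵥ corner r q j = corner r q (j + i) := by
  rw [faceRotation_pow, rotationBy_mulVec_corner]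

theorem corner_add_self (hr : 3 ≤ r) (j : ℤ) : corner r q (j + r) = corner r q j := by
  rw [← faceRotation_pow_mulVec_corner, faceRotation_pow_self hr, one_mulVec]

theorem edgeFun_add_self (hr : 3 ≤ r) (j : ℤ) (y : Fin 3 → ℝ) :
    edgeFun r q (j + r) y = edgeFun r q j y := by
  have : (r : ℝ) ≠ 0 := by norm_cast; omega
  have h : 2 * ((j + r : ℤ) : ℝ) * (π / r) = 2 * j * (π / r) + 2 * π := by
    push_cast; field_simp
  rw [edgeFun, edgeFun, h, cos_add_two_pi, sin_add_two_pi]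

theorem edgeFun_rotationBy (i : ℕ) (j : ℤ) (y : Fin 3 → ℝ) :
    edgeFun r q (j + i) (rotationBy (2 * i * (π / r)) *ᵥ y) = edgeFun r q j y := by
  have h : 2 * ((j + i : ℤ) : ℝ) * (π / r) = 2 * i * (π / r) + 2 * j * (π / r) := by
    push_cast; ring
  simp only [edgeFun, h, rotationBy, Matrix.mulVec, dotProduct, Fin.sum_univ_three, cos_add,
    sin_add]
  simp
  have := sin_sq_add_cos_sq (2 * i * (π / r))
  left
  linear_combination (cos (2 * j * (π / r)) * y 0 + sin (2 * j * (π / r)) * y 1) * this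

theorem edgeFun_faceRotation_pow (i : ℕ) (j : ℤ) (y : Fin 3 → ℝ) :
    edgeFun r q (j + i) (faceRotation r ^ i *ᵥ y) = edgeFun r q j y := by
  rw [faceRotation_pow, edgeFun_rotationBy]

theorem edgeFun_corner (hr : 3 ≤ r) (hq : 3 ≤ q) (i j : ℤ) : edgeFun r q i (corner r q j) =
    cos (π / q) * (cos (π / r) - cos ((2 * (j - i) + 1) * (π / r))) := by
  have h : (2 * ((j : ℝ) - i) + 1) * (π / r) = (2 * j + 1) * (π / r) - 2 * i * (π / r) := by ring
  have := height_mul hr hq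
  rw [h, cos_sub]
  simp only [edgeFun, corner]
  simp
  linear_combination this

end RegularPartition

theorem cos_le_cos_of_le_of_le_two_pi_sub {θ x : ℝ} (h0 : 0 ≤ θ) (h1 : θ ≤ x)
    (h2 : x ≤ 2 * Real.pi - θ) : Real.cos x ≤ Real.cos θ := by
  rcases le_total x Real.pi with h | h
  · exact Real.cos_le_cos_of_nonneg_of_le_pi h0 h h1
  · rw [← Real.cos_two_pi_sub]
    exact Real.cos_le_cos_of_nonneg_of_le_pi h0 (by linarith) (by linarith)

theorem cos_lt_cos_of_lt_of_lt_two_pi_sub {θ x : ℝ} (h0 : 0 ≤ θ) (h1 : θ < x)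
    (h2 : x < 2 * Real.pi - θ) : Real.cos x < Real.cos θ := by
  rcases le_total x Real.pi with h | h
  · exact Real.cos_lt_cos_of_nonneg_of_le_pi h0 h h1
  · rw [← Real.cos_two_pi_sub]
    exact Real.cos_lt_cos_of_nonneg_of_le_pi h0 (by linarith) (by linarith)

/-- The invariant form is the one on linear functionals: for `k = 0` it still detects the Euclidean
metric, whereas the form on points only sees the height. -/
theorem isUnit_geodesicReflection_and_mul_diagonal_mul (k : ℝ) (l : Fin 3 → ℝ) :
    geodesicReflection k l * geodesicReflection k l = 1 ∧
      geodesicReflection k l * Matrix.diagonal ![1, 1, k] * (geodesicReflection k l).transpose =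
        Matrix.diagonal ![1, 1, k] := by
  -- This one relation also covers an isotropic `l`, where division by zero gives `t = 0` and the
  -- identity matrix.
  have hex : ∃ t, t * (t * (l 0 ^ 2 + l 1 ^ 2 + k * l 2 ^ 2) - 2) = 0 ∧
      geodesicReflection k l = 1 - t • Matrix.vecMulVec ![l 0, l 1, k * l 2] l := by
    refine ⟨2 / (l 0 ^ 2 + l 1 ^ 2 + k * l 2 ^ 2), ?_, rfl⟩
    by_cases hD : l 0 ^ 2 + l 1 ^ 2 + k * l 2 ^ 2 = 0
    · simp [hD]
    · rw [div_mul_cancel₀ _ hD]; simp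
  obtain ⟨t, ht, hR⟩ := hex
  rw [hR]
  constructor
  · ext i j
    simp only [Matrix.mul_apply, Fin.sum_univ_three, Matrix.sub_apply, Matrix.smul_apply,
      Matrix.vecMulVec_apply, Matrix.one_apply]
    fin_cases i <;> fin_cases j <;> simp
    · linear_combination (l 0 * l 0) * ht
    · linear_combination (l 0 * l 1) * ht
    · linear_combination (l 0 * l 2) * ht
    · linear_combination (l 1 * l 0) * ht
    · linear_combination (l 1 * l 1) * ht
    · linear_combination (l 1 * l 2) * ht
    · linear_combination (k * l 2 * l 0) * ht
    · linear_combination (k * l 2 * l 1) * ht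
    · linear_combination (k * l 2 * l 2) * ht
  · ext i j
    simp only [Matrix.mul_apply, Fin.sum_univ_three, Matrix.sub_apply, Matrix.smul_apply,
      Matrix.vecMulVec_apply, Matrix.one_apply, Matrix.diagonal_apply, Matrix.transpose_apply]
    fin_cases i <;> fin_cases j <;> simp
    · linear_combination (l 0 * l 0) * ht
    · linear_combination (l 0 * l 1) * ht
    · linear_combination (k * l 0 * l 2) * ht
    · linear_combination (l 1 * l 0) * ht
    · linear_combination (l 1 * l 1) * ht
    · linear_combination (k * l 1 * l 2) * ht
    · linear_combination (k * l 2 * l 0) * ht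
    · linear_combination (k * l 2 * l 1) * ht
    · linear_combination (k * l 2 * k * l 2) * ht

/-! ### Symmetries, half-turns and the half-planes that cut out the base face -/

namespace RegularPartition

open Real Matrix

variable {r q : ℕ}

theorem isUnit_and_mul_diagonal_mul_of_mem_symmetries {g : Matrix (Fin 3) (Fin 3) ℝ}
    (hg : g ∈ symmetries r q) : IsUnit g ∧
      g * Matrix.diagonal ![1, 1, curvature r q] * gᵀ = Matrix.diagonal ![1, 1, curvature r q] := by
  unfold symmetries at hg
  induction hg using Submonoid.closure_induction with
  | mem x hx =>
    have key : ∀ l, x = geodesicReflection (curvature r q) l → IsUnit x ∧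
        x * Matrix.diagonal ![1, 1, curvature r q] * xᵀ =
          Matrix.diagonal ![1, 1, curvature r q] := by
      rintro l rfl
      obtain ⟨h1, h2⟩ := isUnit_geodesicReflection_and_mul_diagonal_mul (curvature r q) l
      exact ⟨.of_mul_eq_one _ h1, h2⟩
    rcases hx with h | h | h <;> exact key _ h
  | one => simp
  | mul x y _ _ hx hy =>
    refine ⟨hx.1.mul hy.1, ?_⟩
    rw [transpose_mul]
    calc x * y * diagonal ![1, 1, curvature r q] * (yᵀ * xᵀ)
        = x * (y * diagonal ![1, 1, curvature r q] * yᵀ) * xᵀ := by simp only [Matrix.mul_assoc]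
      _ = _ := by rw [hy.2, hx.2]

theorem curvature_mul (hr : 3 ≤ r) (hq : 3 ≤ q) :
    curvature r q * (sin (π / r) * sin (π / q)) ^ 2 = sin (π / r) ^ 2 - cos (π / q) ^ 2 := by
  have h1 := height_mul hr hq
  have h2 := sin_sq_add_cos_sq (π / r)
  have h3 := sin_sq_add_cos_sq (π / q)
  rw [curvature, sub_mul, ← mul_pow, h1]
  have h4 : cos (π / r) ^ 2 = 1 - sin (π / r) ^ 2 := by linarith
  have h5 : sin (π / q) ^ 2 = 1 - cos (π / q) ^ 2 := by linarith
  rw [mul_pow, mul_pow, h4, h5]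
  ring

theorem curvature_eq (hr : 3 ≤ r) (hq : 3 ≤ q) : curvature r q =
    (sin (π / r) ^ 2 - cos (π / q) ^ 2) / (sin (π / r) * sin (π / q)) ^ 2 := by
  have h1 := (sin_pi_div_pos (n := r) (by omega)).ne'
  have h2 := (sin_pi_div_pos (n := q) (by omega)).ne'
  rw [eq_div_iff (by positivity), curvature_mul hr hq]

theorem faceRotation_mem_symmetries : faceRotation r ∈ symmetries r q := by
  have h : faceRotation r = geodesicReflection (curvature r q) ![sin (π / r), -cos (π / r), 0] *
      geodesicReflection (curvature r q) ![0, 1, 0] := by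
    have h1 := sin_sq_add_cos_sq (π / r)
    ext i j
    fin_cases i <;> fin_cases j <;>
      simp [faceRotation, rotationBy, geodesicReflection, Matrix.mul_apply, Fin.sum_univ_three,
        Matrix.one_apply, h1, cos_two_mul', sin_two_mul]
    · linear_combination h1
    · ring
    · ring
    · linear_combination -h1
  rw [h]
  exact mul_mem (Submonoid.subset_closure (by simp)) (Submonoid.subset_closure (by simp))

theorem halfTurn_mem_symmetries (hr : 3 ≤ r) (hq : 3 ≤ q) : halfTurn r q ∈ symmetries r q := by
  have h1 := (sin_pi_div_pos (n := r) (by omega)).ne'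
  have h2 := (sin_pi_div_pos (n := q) (by omega)).ne'
  have h3 := (cos_pi_div_pos hr).ne'
  have h4 := sin_sq_add_cos_sq (π / r)
  have h5 := sin_sq_add_cos_sq (π / q)
  have hD : height r q ^ 2 + curvature r q * cos (π / r) ^ 2 =
      cos (π / r) ^ 2 / sin (π / q) ^ 2 := by
    rw [height_eq hr hq, curvature_eq hr hq]
    field_simp
    ring
  have h : halfTurn r q =
      geodesicReflection (curvature r q) ![height r q, 0, -cos (π / r)] *
      geodesicReflection (curvature r q) ![0, 1, 0] := by
    ext i j
    fin_cases i <;> fin_cases j <;>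
      simp [halfTurn, geodesicReflection, Matrix.mul_apply, Fin.sum_univ_three,
        Matrix.one_apply, hD]
    · rw [height_eq hr hq]; field_simp
    · rw [height_eq hr hq]; field_simp
    · norm_num
    · rw [height_eq hr hq]; field_simp
    · rw [curvature_eq hr hq]; field_simp
      ring
  rw [h]
  exact mul_mem (Submonoid.subset_closure (by simp)) (Submonoid.subset_closure (by simp))

/-- The half-turn is `flip`, which exchanges the edges `j` and `-j`, followed by the reflection in
edge `0`, which alters a functional by a multiple of that of edge `0`. -/
theorem edgeFun_halfTurn (hr : 3 ≤ r) (hq : 3 ≤ q) (j : ℤ) (y : Fin 3 → ℝ) :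
    edgeFun r q j (halfTurn r q *ᵥ y) = edgeFun r q (-j) y +
      (2 * cos (π / q) ^ 2 * (1 - cos (2 * j * (π / r))) / sin (π / r) ^ 2 - 2) *
        edgeFun r q 0 y := by
  have h1 := (sin_pi_div_pos (n := r) (by omega)).ne'
  have h2 := (sin_pi_div_pos (n := q) (by omega)).ne'
  simp only [edgeFun, halfTurn, Matrix.mulVec, dotProduct, Fin.sum_univ_three]
  simp
  rw [curvature_eq hr hq]
  field_simp
  ring

/-- The vector through which the reflection in the edge from `corner r q (-1)` to `corner r q 0`
acts. -/
noncomputable def edgePole (r q : ℕ) : Fin 3 → ℝ :=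
  ![-cos (π / q), 0, curvature r q * (sin (π / r) * sin (π / q))]

theorem edgeFun_zero (y : Fin 3 → ℝ) :
    edgeFun r q 0 y = sin (π / r) * sin (π / q) * y 2 - cos (π / q) * y 0 := by
  simp [edgeFun]

theorem edgeFun_edgePole (hr : 3 ≤ r) (hq : 3 ≤ q) :
    edgeFun r q 0 (edgePole r q) = sin (π / r) ^ 2 := by
  have := curvature_mul hr hq
  rw [edgeFun_zero]
  simp [edgePole]
  linear_combination this

theorem corner_neg_one : corner r q (-1) = ![cos (π / r), -sin (π / r), height r q] := by
  have : (2 * ((-1 : ℤ) : ℝ) + 1) * (π / r) = -(π / r) := by push_cast; ring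
  rw [corner, this, cos_neg, sin_neg]

theorem corner_zero : corner r q 0 = ![cos (π / r), sin (π / r), height r q] := by
  simp [corner]

theorem eq_corner_add_corner (hr : 3 ≤ r) (hq : 3 ≤ q) {p : Fin 3 → ℝ}
    (hp : edgeFun r q 0 p = 0) :
    ∃ a b : ℝ, p = a • corner r q (-1) + b • corner r q 0 := by
  have h1 := (sin_pi_div_pos (n := r) (by omega)).ne'
  have h2 := (sin_pi_div_pos (n := q) (by omega)).ne'
  have h3 := (cos_pi_div_pos hr).ne'
  rw [edgeFun_zero] at hp
  refine ⟨(p 0 / cos (π / r) - p 1 / sin (π / r)) / 2,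
    (p 0 / cos (π / r) + p 1 / sin (π / r)) / 2, ?_⟩
  rw [corner_neg_one, corner_zero, height_eq hr hq]
  ext i
  fin_cases i <;> simp
  · field_simp; ring
  · field_simp; ring
  · field_simp; linear_combination 2 * sin (π / r) * hp

theorem eq_edgePole_add_corner_add_corner (hr : 3 ≤ r) (hq : 3 ≤ q) (y : Fin 3 → ℝ) :
    ∃ t a b : ℝ, y = t • edgePole r q + (a • corner r q (-1) + b • corner r q 0) := by
  have h1 := (sin_pi_div_pos (n := r) (by omega)).ne'
  have h := edgeFun_edgePole hr hq
  obtain ⟨a, b, hab⟩ := eq_corner_add_corner hr hq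
    (p := y - (edgeFun r q 0 y / sin (π / r) ^ 2) • edgePole r q) (by
      rw [edgeFun_zero] at h ⊢
      simp only [Pi.sub_apply, Pi.smul_apply, smul_eq_mul]
      have h2 : edgeFun r q 0 y / sin (π / r) ^ 2 * sin (π / r) ^ 2 = edgeFun r q 0 y := by
        field_simp
      rw [edgeFun_zero (y := y)] at h2 ⊢
      linear_combination -(sin (π / r) * sin (π / q) * y 2 - cos (π / q) * y 0) /
        sin (π / r) ^ 2 * h - h2)
  exact ⟨_, a, b, by rw [← hab]; abel⟩

theorem halfTurn_mulVec_edgePole (hr : 3 ≤ r) (hq : 3 ≤ q) :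
    halfTurn r q *ᵥ edgePole r q = -edgePole r q := by
  have h1 := (sin_pi_div_pos (n := r) (by omega)).ne'
  have h2 := (sin_pi_div_pos (n := q) (by omega)).ne'
  ext i
  fin_cases i <;> simp [halfTurn, edgePole, Matrix.mulVec, dotProduct, Fin.sum_univ_three] <;>
    rw [curvature_eq hr hq] <;> field_simp <;> ring

theorem halfTurn_mulVec_corner_neg_one (hr : 3 ≤ r) (hq : 3 ≤ q) :
    halfTurn r q *ᵥ corner r q (-1) = corner r q 0 := by
  have h1 := (sin_pi_div_pos (n := r) (by omega)).ne'
  have h2 := (sin_pi_div_pos (n := q) (by omega)).ne'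
  have h4 := sin_sq_add_cos_sq (π / r)
  rw [corner_neg_one, corner_zero]
  ext i
  fin_cases i <;> simp [halfTurn, Matrix.mulVec, dotProduct, Fin.sum_univ_three] <;>
    rw [height_eq hr hq] <;> (try rw [curvature_eq hr hq]) <;> field_simp <;> ring

theorem halfTurn_mul_self (hr : 3 ≤ r) (hq : 3 ≤ q) : halfTurn r q * halfTurn r q = 1 := by
  have h1 := (sin_pi_div_pos (n := r) (by omega)).ne'
  have h2 := (sin_pi_div_pos (n := q) (by omega)).ne'
  ext i j
  fin_cases i <;> fin_cases j <;>
    simp [halfTurn, Matrix.mul_apply, Fin.sum_univ_three] <;>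
    (try rw [curvature_eq hr hq]) <;> field_simp <;> ring

theorem halfTurn_mulVec_corner_zero (hr : 3 ≤ r) (hq : 3 ≤ q) :
    halfTurn r q *ᵥ corner r q 0 = corner r q (-1) := by
  rw [← halfTurn_mulVec_corner_neg_one hr hq, mulVec_mulVec, halfTurn_mul_self hr hq, one_mulVec]

theorem flip_mulVec_corner (j : ℤ) : flip *ᵥ corner r q j = corner r q (-1 - j) := by
  have : (2 * ((-1 - j : ℤ) : ℝ) + 1) * (π / r) = -((2 * j + 1) * (π / r)) := by
    push_cast; ring
  simp only [corner]
  rw [this, cos_neg, sin_neg]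
  ext i
  fin_cases i <;> simp [flip, Matrix.mulVec, dotProduct, Fin.sum_univ_three]

theorem flip_mulVec_edgePole : flip *ᵥ edgePole r q = edgePole r q := by
  ext i
  fin_cases i <;> simp [flip, edgePole, Matrix.mulVec, dotProduct, Fin.sum_univ_three]

theorem ext_of_corner_of_edgePole (hr : 3 ≤ r) (hq : 3 ≤ q) {A B : Matrix (Fin 3) (Fin 3) ℝ}
    (h1 : A *ᵥ corner r q (-1) = B *ᵥ corner r q (-1)) (h2 : A *ᵥ corner r q 0 = B *ᵥ corner r q 0)
    (h3 : A *ᵥ edgePole r q = B *ᵥ edgePole r q) : A = B := by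
  refine Matrix.ext_iff_mulVec.2 fun y => ?_
  obtain ⟨t, a, b, rfl⟩ := eq_edgePole_add_corner_add_corner hr hq y
  simp only [mulVec_add, mulVec_smul, h1, h2, h3]

/-- A symmetry that exchanges the end points of an edge is the half-turn around the midpoint of
this edge, or it preserves both faces at the edge. -/
theorem eq_halfTurn_or_eq_flip (hr : 3 ≤ r) (hq : 3 ≤ q) {A : Matrix (Fin 3) (Fin 3) ℝ}
    (hA : A * Matrix.diagonal ![1, 1, curvature r q] * Aᵀ =
      Matrix.diagonal ![1, 1, curvature r q])
    (h1 : A *ᵥ corner r q (-1) = corner r q 0) (h2 : A *ᵥ corner r q 0 = corner r q (-1)) :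
    A = halfTurn r q ∨ A = flip := by
  have s0 := (sin_pi_div_pos (n := r) (by omega)).ne'
  have S0 := (sin_pi_div_pos (n := q) (by omega)).ne'
  have c0 := (cos_pi_div_pos hr).ne'
  set J := Matrix.diagonal ![1, 1, curvature r q] with hJ
  set e : Fin 3 → ℝ := ![-cos (π / q), 0, sin (π / r) * sin (π / q)] with he
  have hJe : J *ᵥ e = edgePole r q := by
    ext i
    fin_cases i <;> simp [hJ, he, edgePole, Matrix.mulVec_diagonal]
  have hedge : ∀ y, e ⬝ᵥ y = edgeFun r q 0 y := fun y => by
    rw [edgeFun_zero]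
    simp [he, dotProduct, Fin.sum_univ_three]
    ring
  have hcorner : edgeFun r q 0 (corner r q 0) = 0 ∧ edgeFun r q 0 (corner r q (-1)) = 0 := by
    rw [edgeFun_corner hr hq, edgeFun_corner hr hq]
    norm_num
  -- `A` exchanges the ends of the edge, so it preserves the functionals vanishing on both ends,
  -- which form a line. Invariance of the form then gives `κ = ±1`, the sign telling whether the two
  -- sides of the edge are exchanged.
  obtain ⟨κ, hκ⟩ : ∃ κ : ℝ, Aᵀ *ᵥ e = κ • e := by
    have f1 : (Aᵀ *ᵥ e) ⬝ᵥ corner r q (-1) = 0 := by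
      rw [mulVec_transpose, ← dotProduct_mulVec, h1, hedge, hcorner.1]
    have f2 : (Aᵀ *ᵥ e) ⬝ᵥ corner r q 0 = 0 := by
      rw [mulVec_transpose, ← dotProduct_mulVec, h2, hedge, hcorner.2]
    generalize Aᵀ *ᵥ e = f at f1 f2
    rw [corner_neg_one] at f1
    rw [corner_zero] at f2
    simp [dotProduct, Fin.sum_univ_three] at f1 f2
    have f3 : f 1 = 0 := by
      have : f 1 * sin (π / r) = 0 := by linarith
      exact (mul_eq_zero.1 this).resolve_right s0
    have f4 : f 0 * cos (π / r) + f 2 * height r q = 0 := by rw [f3] at f1; linarith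
    rw [height_eq hr hq] at f4
    refine ⟨f 2 / (sin (π / r) * sin (π / q)), ?_⟩
    ext i
    fin_cases i <;> simp [he]
    · have : (f 0 * (sin (π / r) * sin (π / q)) + f 2 * cos (π / q)) * cos (π / r) = 0 := by
        field_simp at f4
        linear_combination f4
      have := (mul_eq_zero.1 this).resolve_right c0
      field_simp
      linear_combination this
    · exact f3
    · field_simp
  have hpole : κ • (A *ᵥ edgePole r q) = edgePole r q := by
    calc κ • (A *ᵥ edgePole r q) = (A * J * Aᵀ) *ᵥ e := by
          rw [← mulVec_mulVec, hκ, mulVec_smul, ← mulVec_mulVec, hJe]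
      _ = _ := by rw [hA, hJe]
  have hκ2 : κ * κ = 1 := by
    have f1 : e ⬝ᵥ (κ • (A *ᵥ edgePole r q)) = κ * κ * (e ⬝ᵥ edgePole r q) := by
      rw [dotProduct_smul, dotProduct_mulVec, ← mulVec_transpose, hκ, smul_dotProduct]
      simp [mul_assoc]
    rw [hpole, hedge, edgeFun_edgePole hr hq] at f1
    have : (κ * κ - 1) * sin (π / r) ^ 2 = 0 := by linarith
    have := (mul_eq_zero.1 this).resolve_right (by positivity)
    linarith
  have hpole' : A *ᵥ edgePole r q = κ • edgePole r q := by
    conv_rhs => rw [← hpole, smul_smul, hκ2, one_smul]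
  rcases mul_self_eq_one_iff.1 hκ2 with rfl | rfl
  · right
    apply ext_of_corner_of_edgePole hr hq
    · rw [h1, flip_mulVec_corner]; norm_num
    · rw [h2, flip_mulVec_corner]; norm_num
    · rw [hpole', flip_mulVec_edgePole, one_smul]
  · left
    apply ext_of_corner_of_edgePole hr hq
    · rw [h1, halfTurn_mulVec_corner_neg_one hr hq]
    · rw [h2, halfTurn_mulVec_corner_zero hr hq]
    · rw [hpole', halfTurn_mulVec_edgePole hr hq, neg_one_smul]

theorem edgeFun_corner_pos (hr : 3 ≤ r) (hq : 3 ≤ q) {i j : ℤ} (h1 : i < j) (h2 : j < i + r - 1) :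
    0 < edgeFun r q i (corner r q j) := by
  have hr0 : (0 : ℝ) < r := by norm_cast; omega
  have h1' : (i : ℝ) + 1 ≤ j := by exact_mod_cast h1
  have h2' : (j : ℝ) + 2 ≤ i + r := by exact_mod_cast (show j + 2 ≤ i + r by omega)
  have hθ : 0 < π / r := by positivity
  have hrθ : r * (π / r) = π := by field_simp
  rw [edgeFun_corner hr hq]
  apply mul_pos (cos_pi_div_pos hq)
  rw [sub_pos]
  apply cos_lt_cos_of_lt_of_lt_two_pi_sub hθ.le
  · nlinarith
  · nlinarith

theorem edgeFun_corner_self (hr : 3 ≤ r) (hq : 3 ≤ q) (i : ℤ) :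
    edgeFun r q i (corner r q i) = 0 := by
  rw [edgeFun_corner hr hq]
  norm_num

theorem edgeFun_corner_sub_one (hr : 3 ≤ r) (hq : 3 ≤ q) (i : ℤ) :
    edgeFun r q i (corner r q (i - 1)) = 0 := by
  rw [edgeFun_corner hr hq]
  have : (2 * (((i - 1 : ℤ) : ℝ) - i) + 1) * (π / r) = -(π / r) := by push_cast; ring
  rw [this, cos_neg, sub_self, mul_zero]

theorem corner_add_mul_self (hr : 3 ≤ r) (j k : ℤ) : corner r q (j + r * k) = corner r q j := by
  induction k using Int.induction_on with
  | zero => simp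
  | succ k ih => rw [show j + (r : ℤ) * (k + 1) = j + r * k + r by ring, corner_add_self hr, ih]
  | pred k ih =>
    rw [← corner_add_self hr, show j + (r : ℤ) * (-k - 1) + r = j + r * -k by ring, ih]

theorem edgeFun_add_mul_self (hr : 3 ≤ r) (j k : ℤ) (y : Fin 3 → ℝ) :
    edgeFun r q (j + r * k) y = edgeFun r q j y := by
  induction k using Int.induction_on with
  | zero => simp
  | succ k ih => rw [show j + (r : ℤ) * (k + 1) = j + r * k + r by ring, edgeFun_add_self hr, ih]
  | pred k ih =>
    rw [← edgeFun_add_self hr, show j + (r : ℤ) * (-k - 1) + r = j + r * -k by ring, ih]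

theorem edgeFun_corner_nonneg (hr : 3 ≤ r) (hq : 3 ≤ q) (i j : ℤ) :
    0 ≤ edgeFun r q i (corner r q j) := by
  have hr0 : (0 : ℤ) < r := by omega
  have h1 := Int.emod_nonneg (j - i) hr0.ne'
  have h2 := Int.emod_lt_of_pos (j - i) hr0
  have h3 : j = (i + (j - i) % r) + r * ((j - i) / r) := by
    have := Int.emod_add_mul_ediv (j - i) r
    omega
  rw [h3, corner_add_mul_self hr]
  generalize (j - i) % (r : ℤ) = m at h1 h2
  rcases eq_or_lt_of_le h1 with rfl | h1
  · rw [add_zero, edgeFun_corner_self hr hq]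
  · by_cases hm : m = r - 1
    · rw [hm, show i + ((r : ℤ) - 1) = (i - 1) + r by ring, corner_add_self hr,
        edgeFun_corner_sub_one hr hq]
    · exact (edgeFun_corner_pos hr hq (by omega) (by omega)).le

theorem corner_injective_of_lt (hr : 3 ≤ r) (hq : 3 ≤ q) {i j : ℤ} (h1 : i - j < r)
    (h2 : j - i < r) (h : corner r q i = corner r q j) : i = j := by
  have key : ∀ i j : ℤ, i < j → j - i < r → corner r q i ≠ corner r q j := by
    intro i j hij hji he
    by_cases hm : j = i + r - 1
    · have h5 := edgeFun_corner_self hr hq j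
      have h6 := edgeFun_corner_pos hr hq (i := j) (j := i + r) (by omega) (by omega)
      rw [corner_add_self hr, he, h5] at h6
      exact h6.false
    · have := edgeFun_corner_pos hr hq hij (by omega)
      rw [← he, edgeFun_corner_self hr hq] at this
      exact this.false
  rcases lt_trichotomy i j with hij | hij | hij
  · exact absurd h (key i j hij h2)
  · exact hij
  · exact absurd h.symm (key j i hij h1)

theorem edgeFun_add (j : ℤ) (x y : Fin 3 → ℝ) :
    edgeFun r q j (x + y) = edgeFun r q j x + edgeFun r q j y := by
  simp only [edgeFun, Pi.add_apply]; ring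

theorem edgeFun_smul (j : ℤ) (a : ℝ) (x : Fin 3 → ℝ) :
    edgeFun r q j (a • x) = a * edgeFun r q j x := by
  simp only [edgeFun, Pi.smul_apply, smul_eq_mul]; ring

/-- Each adjacent edge contains one of the two corners, so its functional reads off the coefficient
of the other one. -/
theorem exists_nonneg_corner_add_corner (hr : 3 ≤ r) (hq : 3 ≤ q) {p : Fin 3 → ℝ}
    (hp : edgeFun r q 0 p = 0) (h1 : 0 ≤ edgeFun r q 1 p) (h2 : 0 ≤ edgeFun r q (-1) p) :
    ∃ a b : ℝ, 0 ≤ a ∧ 0 ≤ b ∧ p = a • corner r q (-1) + b • corner r q 0 := by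
  obtain ⟨a, b, rfl⟩ := eq_corner_add_corner hr hq hp
  have e1 := edgeFun_corner_sub_one (q := q) hr hq 1
  have e2 := edgeFun_corner_self (q := q) hr hq (-1)
  have e3 := edgeFun_corner_pos (q := q) hr hq (i := -1) (j := 0) (by omega) (by omega)
  have e4 := edgeFun_corner_pos (q := q) hr hq (i := 1) (j := -1 + r) (by omega) (by omega)
  rw [corner_add_self hr] at e4
  rw [sub_self] at e1
  rw [edgeFun_add, edgeFun_smul, edgeFun_smul, e1, mul_zero, add_zero] at h1
  rw [edgeFun_add, edgeFun_smul, edgeFun_smul, e2, mul_zero, zero_add] at h2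
  exact ⟨a, b, nonneg_of_mul_nonneg_left h1 e4, nonneg_of_mul_nonneg_left h2 e3, rfl⟩

/-- The sum is fixed by the rotation of the face, hence lies on its axis. -/
theorem sum_corner (hr : 3 ≤ r) :
    ∑ j ∈ Finset.range r, corner r q j = ![0, 0, r * height r q] := by
  set v := ∑ j ∈ Finset.range r, corner r q j with hv
  have hrot : faceRotation r *ᵥ v = v := by
    have h1 : faceRotation r *ᵥ v = ∑ j ∈ Finset.range r, corner r q (j + 1 : ℕ) := by
      rw [hv, mulVec_sum]
      refine Finset.sum_congr rfl fun j _ => ?_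
      have := faceRotation_pow_mulVec_corner (r := r) (q := q) 1 j
      simpa using this
    have h2 := Finset.sum_range_succ' (fun j : ℕ => corner r q j) r
    have h3 := Finset.sum_range_succ (fun j : ℕ => corner r q j) r
    have h4 : corner r q (r : ℕ) = corner r q (0 : ℕ) := by
      have := corner_add_self (q := q) hr 0
      simpa using this
    rw [h1, hv]
    rw [h3, h4] at h2
    exact (add_right_cancel h2).symm
  have h2 : v 2 = r * height r q := by
    rw [hv, Finset.sum_apply]
    simp [corner]
  have e0 := congrFun hrot 0
  have e1 := congrFun hrot 1
  simp [faceRotation, rotationBy, Matrix.mulVec, dotProduct, Fin.sum_univ_three] at e0 e1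
  have hs := sin_pi_div_pos (n := r) (by omega)
  have h3 := sin_sq_add_cos_sq (2 * (π / r))
  have h4 : 2 - 2 * cos (2 * (π / r)) ≠ 0 := by
    rw [cos_two_mul']
    have := sin_sq_add_cos_sq (π / r)
    nlinarith
  have e2 : (2 - 2 * cos (2 * (π / r))) * v 0 = 0 := by
    linear_combination (cos (2 * (π / r)) - 1) * e0 + sin (2 * (π / r)) * e1 - v 0 * h3
  have e3 : (2 - 2 * cos (2 * (π / r))) * v 1 = 0 := by
    linear_combination (cos (2 * (π / r)) - 1) * e1 - sin (2 * (π / r)) * e0 - v 1 * h3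
  ext i
  fin_cases i
  · exact (mul_eq_zero.1 e2).resolve_left h4
  · exact (mul_eq_zero.1 e3).resolve_left h4
  · exact h2

/-- The base face is the intersection of the half-planes bounded by its edges. -/
theorem exists_nonneg_combination (hr : 3 ≤ r) (hq : 3 ≤ q) {y : Fin 3 → ℝ}
    (hy : ∀ j, 0 ≤ edgeFun r q j y) : ∃ (i : ℤ) (a b t : ℝ), 0 ≤ a ∧ 0 ≤ b ∧ 0 ≤ t ∧
      y = a • corner r q (i - 1) + b • corner r q i + t • ∑ j ∈ Finset.range r, corner r q j := by
  have hs := sin_pi_div_pos (n := r) (by omega)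
  have hS := sin_pi_div_pos (n := q) (by omega)
  have hc := cos_pi_div_pos hr
  have hh := height_pos hr hq
  have hr0 : (0 : ℝ) < r := by norm_cast; omega
  have hθ : 0 < π / r := by positivity
  have hrθ : r * (π / r) = π := by field_simp
  have hr3 : (3 : ℝ) ≤ r := by exact_mod_cast hr
  obtain ⟨R, φ, hR, h0, h1⟩ : ∃ R φ : ℝ, 0 ≤ R ∧ y 0 = R * cos φ ∧ y 1 = R * sin φ := by
    refine ⟨‖(⟨y 0, y 1⟩ : ℂ)‖, Complex.arg ⟨y 0, y 1⟩, norm_nonneg _, ?_, ?_⟩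
    · rw [Complex.norm_mul_cos_arg]
    · rw [Complex.norm_mul_sin_arg]
  -- Edge `i` is the one whose sector contains the direction of `y`. There the horizontal part of
  -- `y` is a nonnegative combination of the two ends of the edge, and the inequality for `i` makes
  -- the remainder along the axis nonnegative.
  set i := round (φ / (2 * (π / r))) with hi
  obtain ⟨ψ, hψ⟩ : ∃ ψ, φ = 2 * i * (π / r) + ψ := ⟨φ - 2 * i * (π / r), by ring⟩
  have hψ1 : |ψ| ≤ π / r := by
    have := abs_sub_round (φ / (2 * (π / r)))
    rw [← hi, show φ / (2 * (π / r)) - i = ψ / (2 * (π / r)) by rw [hψ]; field_simp; ring, abs_div,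
      abs_of_pos (show 0 < 2 * (π / r) by positivity), div_le_iff₀ (by positivity)] at this
    linarith
  rw [abs_le] at hψ1
  have sp : 0 ≤ sin (π / r + ψ) := sin_nonneg_of_nonneg_of_le_pi (by linarith) (by nlinarith)
  have sm : 0 ≤ sin (π / r - ψ) := sin_nonneg_of_nonneg_of_le_pi (by linarith) (by nlinarith)
  rw [sin_add] at sp
  rw [sin_sub] at sm
  have hyi := hy i
  have hcos : cos (2 * i * (π / r)) * y 0 + sin (2 * i * (π / r)) * y 1 = R * cos ψ := by
    rw [h0, h1, hψ, cos_add, sin_add]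
    have := sin_sq_add_cos_sq (2 * i * (π / r))
    linear_combination R * cos ψ * this
  rw [edgeFun, hcos, sub_nonneg] at hyi
  have e1 : (2 * ((i - 1 : ℤ) : ℝ) + 1) * (π / r) = 2 * i * (π / r) - π / r := by push_cast; ring
  have e2 : (2 * (i : ℝ) + 1) * (π / r) = 2 * i * (π / r) + π / r := by ring
  have hheight : 0 ≤ y 2 - R * cos ψ / cos (π / r) * height r q := by
    rw [height_eq hr hq]
    rw [show R * cos ψ / cos (π / r) * (cos (π / r) * cos (π / q) / (sin (π / r) * sin (π / q))) =
      cos (π / q) * (R * cos ψ) / (sin (π / r) * sin (π / q)) by field_simp, sub_nonneg,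
      div_le_iff₀ (by positivity)]
    linarith
  have hsq := sin_sq_add_cos_sq (π / r)
  refine ⟨i, R * (sin (π / r) * cos ψ - cos (π / r) * sin ψ) / (2 * sin (π / r) * cos (π / r)),
    R * (sin (π / r) * cos ψ + cos (π / r) * sin ψ) / (2 * sin (π / r) * cos (π / r)),
    (y 2 - R * cos ψ / cos (π / r) * height r q) / (r * height r q), by positivity, by positivity,
    by positivity, ?_⟩
  rw [sum_corner hr, corner, corner, e1, e2, sin_add, sin_sub, cos_add, cos_sub]
  ext k
  fin_cases k <;> simp
  · rw [h0, hψ, cos_add]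
    field_simp
    ring
  · rw [h1, hψ, sin_add]
    field_simp
    ring
  · field_simp
    ring

theorem mulVec_mem_of_edgeFun_nonneg (hr : 3 ≤ r) (hq : 3 ≤ q) {M : Matrix (Fin 3) (Fin 3) ℝ}
    {K : PointedCone ℝ (Fin 3 → ℝ)} (hK : ∀ j, M *ᵥ corner r q j ∈ K) {y : Fin 3 → ℝ}
    (hy : ∀ j, 0 ≤ edgeFun r q j y) : M *ᵥ y ∈ K := by
  obtain ⟨i, a, b, t, ha, hb, ht, rfl⟩ := exists_nonneg_combination hr hq hy
  simp only [mulVec_add, mulVec_smul, mulVec_sum]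
  refine K.add_mem (K.add_mem ?_ ?_) ?_
  · exact K.smul_mem ha (hK _)
  · exact K.smul_mem hb (hK _)
  · exact K.smul_mem ht (K.sum_mem fun j _ => hK _)

/-- Three consecutive corners span `ℝ³`, because corner `1` is off edge `0`. -/
theorem ext_of_corner (hr : 3 ≤ r) (hq : 3 ≤ q) {A B : Matrix (Fin 3) (Fin 3) ℝ}
    (h : ∀ j, A *ᵥ corner r q j = B *ᵥ corner r q j) : A = B := by
  obtain ⟨t, a, b, h1⟩ := eq_edgePole_add_corner_add_corner hr hq (corner r q 1)
  have ht : t ≠ 0 := by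
    rintro rfl
    have h2 := edgeFun_corner_pos hr hq (i := 0) (j := 1) (by omega) (by omega)
    have h3 := edgeFun_corner_self hr hq 0
    have h4 := edgeFun_corner_sub_one hr hq 0
    rw [h1, zero_smul, zero_add, edgeFun_add, edgeFun_smul, edgeFun_smul, h3] at h2
    rw [zero_sub] at h4
    rw [h4] at h2
    simp at h2
  apply ext_of_corner_of_edgePole hr hq (h _) (h _)
  have h2 := h 1
  rw [h1] at h2
  simp only [mulVec_add, mulVec_smul, h] at h2
  exact smul_right_injective _ ht (add_right_cancel h2)

end RegularPartition

/-! ### Developments of the bounded faces and cell-homomorphisms -/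

namespace PlaneMap

open RegularPartition Matrix

variable {V : Type u} {G : SimpleGraph V}

/-- A development of the bounded faces into the regular partition `(r^n)`: `pos` maps the
vertices, and the symmetry `M d` maps the base face to the image of the face of `d`, its edge from
`corner r n (-1)` to `corner r n 0` being mapped to the image of `d`. -/
structure IsDevelopment (P : PlaneMap G) (r n : ℕ) (M : G.Dart → Matrix (Fin 3) (Fin 3) ℝ)
    (pos : V → Fin 3 → ℝ) : Prop where
  mem : ∀ d ∈ P.bounded, M d ∈ symmetries r n
  pos_eq : ∀ d ∈ P.bounded, pos d.fst = M d *ᵥ corner r n (-1)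
  next : ∀ d ∈ P.bounded, M (P.next d) = M d * faceRotation r
  symm : ∀ d ∈ P.bounded, d.symm ∈ P.bounded → M d.symm = M d * halfTurn r n

theorem IsOuterplanarRealization.image_faceVerts {P : PlaneMap G} {r q n : ℕ}
    (h : P.IsOuterplanarRealization r q) {d : G.Dart} (hd : d ∈ P.bounded)
    {A : Matrix (Fin 3) (Fin 3) ℝ} {pos : V → Fin 3 → ℝ}
    (hA : ∀ i : ℕ, pos ((P.next ^ i) d).fst = A *ᵥ corner r n (i - 1)) :
    pos '' P.faceVerts d = Set.range fun j => A *ᵥ corner r n j := by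
  have hr := h.three_le
  ext x
  constructor
  · rintro ⟨_, ⟨d', hdd', rfl⟩, rfl⟩
    obtain ⟨i, -, rfl⟩ := h.exists_next_pow_eq hd hdd'
    exact ⟨_, (hA i).symm⟩
  · rintro ⟨j, rfl⟩
    have hr0 : (0 : ℤ) < r := by omega
    have h1 := Int.emod_nonneg (j + 1) hr0.ne'
    refine ⟨_, ⟨(P.next ^ ((j + 1) % r).toNat) d,
      ⟨((j + 1) % r).toNat, by rw [zpow_natCast]⟩, rfl⟩, ?_⟩
    rw [hA, Int.toNat_of_nonneg h1]
    have h2 : j = ((j + 1) % r - 1) + r * ((j + 1) / r) := by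
      have := Int.emod_add_mul_ediv (j + 1) r
      omega
    conv_rhs => rw [h2]
    dsimp only
    rw [corner_add_mul_self hr]

namespace IsDevelopment

variable {P : PlaneMap G} {r n : ℕ} {M : G.Dart → Matrix (Fin 3) (Fin 3) ℝ}
  {pos : V → Fin 3 → ℝ} (D : P.IsDevelopment r n M pos)
include D

theorem next_pow {d : G.Dart} (hd : d ∈ P.bounded) (i : ℕ) :
    M ((P.next ^ i) d) = M d * faceRotation r ^ i := by
  induction i with
  | zero => simp
  | succ i ih =>
    rw [pow_succ', Equiv.Perm.mul_apply, D.next _ (P.next_pow_mem_bounded hd i), ih, mul_assoc,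
      pow_succ]

theorem pos_next_pow {d : G.Dart} (hd : d ∈ P.bounded) (i : ℕ) :
    pos ((P.next ^ i) d).fst = M d *ᵥ corner r n (i - 1) := by
  rw [D.pos_eq _ (P.next_pow_mem_bounded hd i), D.next_pow hd, ← mulVec_mulVec,
    faceRotation_pow_mulVec_corner, add_comm, sub_eq_add_neg]

theorem pos_snd {d : G.Dart} (hd : d ∈ P.bounded) : pos d.snd = M d *ᵥ corner r n 0 := by
  have := D.pos_next_pow hd 1
  rwa [pow_one, P.next_fst, Nat.cast_one, sub_self] at this

theorem inv_mulVec_mulVec {d : G.Dart} (hd : d ∈ P.bounded) (y : Fin 3 → ℝ) :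
    (M d)⁻¹ *ᵥ (M d *ᵥ y) = y := by
  have := (isUnit_and_mul_diagonal_mul_of_mem_symmetries (D.mem d hd)).1
  rw [mulVec_mulVec, nonsing_inv_mul _ ((isUnit_iff_isUnit_det _).1 this), one_mulVec]

theorem mulVec_inv_mulVec {d : G.Dart} (hd : d ∈ P.bounded) (y : Fin 3 → ℝ) :
    M d *ᵥ ((M d)⁻¹ *ᵥ y) = y := by
  have := (isUnit_and_mul_diagonal_mul_of_mem_symmetries (D.mem d hd)).1
  rw [mulVec_mulVec, mul_nonsing_inv _ ((isUnit_iff_isUnit_det _).1 this), one_mulVec]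

/-- The change of coordinates when a chain moves on through edge `i` of its last face. All
propagation arguments below rest on it. -/
theorem edgeFun_step (hr : 3 ≤ r) (hn : 3 ≤ n) {d : G.Dart} (hd : d ∈ P.bounded) {i : ℕ}
    (hi : ((P.next ^ i) d).symm ∈ P.bounded) (x : Fin 3 → ℝ) (j : ℤ) :
    edgeFun r n j ((M ((P.next ^ i) d).symm)⁻¹ *ᵥ x) = edgeFun r n (i - j) ((M d)⁻¹ *ᵥ x) +
      (2 * Real.cos (Real.pi / n) ^ 2 * (1 - Real.cos (2 * j * (Real.pi / r))) /
        Real.sin (Real.pi / r) ^ 2 - 2) * edgeFun r n i ((M d)⁻¹ *ᵥ x) := by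
  have hM : M ((P.next ^ i) d).symm = M d * faceRotation r ^ i * halfTurn r n := by
    rw [D.symm _ (P.next_pow_mem_bounded hd i) hi, D.next_pow hd]
  set w := (M ((P.next ^ i) d).symm)⁻¹ *ᵥ x with hw
  have hx : (M d)⁻¹ *ᵥ x = faceRotation r ^ i *ᵥ (halfTurn r n *ᵥ w) := by
    rw [← D.mulVec_inv_mulVec hi x, ← hw, hM, ← mulVec_mulVec, ← mulVec_mulVec,
      D.inv_mulVec_mulVec hd]
  have h1 := edgeFun_faceRotation_pow (r := r) (q := n) i (-j) (halfTurn r n *ᵥ w)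
  have h2 := edgeFun_faceRotation_pow (r := r) (q := n) i 0 (halfTurn r n *ᵥ w)
  have h3 := edgeFun_halfTurn hr hn j (halfTurn r n *ᵥ w)
  rw [mulVec_mulVec, halfTurn_mul_self hr hn, one_mulVec] at h3
  rw [hx, h3, ← h1, ← h2, zero_add, neg_add_eq_sub]

end IsDevelopment

/-- Trivialize the local system with `ρ` the rotation of a face and `τ` the half-turn about the
midpoint of an edge. -/
theorem IsOuterplanarRealization.exists_isDevelopment {P : PlaneMap G} {r q n : ℕ}
    (h : P.IsOuterplanarRealization r q) (hn : 3 ≤ n) : ∃ M pos, P.IsDevelopment r n M pos := by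
  have hr := h.three_le
  obtain ⟨v₀⟩ := h.connected.nonempty
  obtain ⟨a, ha, -⟩ := h.exists_bounded v₀
  obtain ⟨M, h1, h2, h3⟩ := h.exists_trivialization (faceRotation_pow_self hr)
    (halfTurn_mul_self hr hn) ha
  choose δ hδ hδv using h.exists_bounded
  have hmem : ∀ d m k, P.Holonomy (faceRotation r) (halfTurn r n) a d m k →
      m ∈ symmetries r n := by
    intro d m k H
    induction H with
    | refl => exact one_mem _
    | next _ _ ih => exact mul_mem ih faceRotation_mem_symmetries
    | cross _ _ _ ih => exact mul_mem ih (halfTurn_mem_symmetries hr hn)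
  refine ⟨M, fun v => M (δ v) *ᵥ corner r n (-1), fun d hd => ?_, fun d hd => ?_, h2, h3⟩
  · obtain ⟨k, H⟩ := h1 d hd
    exact hmem d _ k H
  -- The position of a vertex is independent of the face used: rotating to the next corner
  -- multiplies `M` by half-turn and face rotation, and this product fixes `corner r n (-1)`.
  · refine h.eq_of_fst_eq (F := fun z => M z *ᵥ corner r n (-1)) ?_ (hδ _) hd (hδv _)
    intro z hz hz'
    rw [← P.next_symm, P.bounded_next] at hz'
    have h4 := faceRotation_pow_mulVec_corner (r := r) (q := n) 1 (-1)
    rw [pow_one] at h4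
    rw [← P.next_symm, h2 _ hz', h3 _ hz hz', ← mulVec_mulVec, h4, ← mulVec_mulVec]
    simp [halfTurn_mulVec_corner_zero hr hn]

/-- The homomorphism into the skeleton given by a development. -/
theorem IsDevelopment.exists_hom {P : PlaneMap G} {r q n : ℕ}
    (h : P.IsOuterplanarRealization r q) (hn : 3 ≤ n) {M : G.Dart → Matrix (Fin 3) (Fin 3) ℝ}
    {pos : V → Fin 3 → ℝ} (D : P.IsDevelopment r n M pos) :
    ∃ f : G →g skeleton r n, P.IsCellHom r n f ∧ ∀ v, (f v).1 = pos v := by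
  have hr := h.three_le
  have hbase : ∀ i : ℕ, baseVertex r n (i + (r - 1)) = corner r n (i - 1) := by
    intro i
    rw [baseVertex_eq_corner, ← corner_add_self hr (i - 1)]
    congr 1
    omega
  have hvert : ∀ v, pos v ∈ vertices r n := by
    intro v
    obtain ⟨d, hd, rfl⟩ := h.exists_bounded v
    exact ⟨M d, D.mem d hd, 0 + (r - 1), by rw [hbase, D.pos_eq d hd]; rfl⟩
  have hadj : ∀ d ∈ P.bounded, (skeleton r n).Adj ⟨pos d.fst, hvert _⟩ ⟨pos d.snd, hvert _⟩ := by
    intro d hd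
    rw [skeleton, SimpleGraph.fromRel_adj]
    constructor
    · intro he
      have he := congrArg (fun y => (M d)⁻¹ *ᵥ y) (Subtype.ext_iff.1 he)
      simp only [D.pos_snd hd, D.pos_eq d hd, D.inv_mulVec_mulVec hd] at he
      exact absurd (corner_injective_of_lt hr hn (by omega) (by omega) he) (by decide)
    · left
      refine ⟨M d, D.mem d hd, 0 + (r - 1), ?_, ?_⟩
      · rw [hbase]; exact D.pos_eq d hd
      · rw [show 0 + (r - 1) + 1 = 1 + (r - 1) by omega, hbase]; exact D.pos_snd hd
  let f : G →g skeleton r n :=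
    { toFun := fun v => ⟨pos v, hvert v⟩
      map_rel' := by
        intro a b hab
        rcases h.bounded_or_symm_bounded ⟨(a, b), hab⟩ with hd | hd
        · exact hadj _ hd
        · exact (hadj _ hd).symm }
  have himage : ∀ d ∈ P.bounded, (fun v => (f v).1) '' P.faceVerts d =
      Set.range fun j => M d *ᵥ corner r n j := fun d hd =>
    h.image_faceVerts hd (D.pos_next_pow hd)
  refine ⟨f, ⟨fun d hd => ⟨M d * (faceRotation r) ^ (r - 1), ?_, fun i => ?_⟩, ?_⟩, fun v => rfl⟩
  · exact mul_mem (D.mem d hd) (pow_mem faceRotation_mem_symmetries _)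
  · rw [← mulVec_mulVec, baseVertex_eq_corner, faceRotation_pow_mulVec_corner]
    refine (D.pos_next_pow hd i).trans ?_
    congr 1
    rw [← corner_add_self hr]
    congr 1
    omega
  -- Both faces lie on a common edge, but the functional of that edge is nonnegative on the one and
  -- negative at a corner of the other.
  · intro d hd hd' he
    have h1 : (fun v => (f v).1) '' P.faceVerts d = (fun v => (f v).1) '' P.faceVerts d.symm := by
      have := congrArg (fun s => Subtype.val '' s) he
      simpa only [Set.image_image] using this
    rw [himage d hd, himage _ hd', D.symm d hd hd'] at h1
    have h2 : (M d * halfTurn r n) *ᵥ corner r n 1 ∈ Set.range fun j => M d *ᵥ corner r n j := by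
      rw [h1]; exact ⟨1, rfl⟩
    obtain ⟨j, hj⟩ := h2
    have hj := congrArg (fun y => (M d)⁻¹ *ᵥ y) hj
    simp only [← mulVec_mulVec, D.inv_mulVec_mulVec hd] at hj
    have h3 := edgeFun_halfTurn hr hn 0 (corner r n 1)
    have h4 := edgeFun_corner_pos hr hn (i := 0) (j := 1) (by omega) (by omega)
    have h5 := edgeFun_corner_nonneg hr hn 0 j
    rw [hj, h3] at h5
    simp at h5
    linarith

/-- Each face supplies a symmetry. For adjacent faces the two symmetries differ by one that
exchanges the ends of the common edge, so by the half-turn or by `flip`; the latter would fold the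
faces together. -/
theorem IsCellHom.exists_isDevelopment {P : PlaneMap G} {r q n : ℕ}
    (h : P.IsOuterplanarRealization r q) (hn : 3 ≤ n) {f : G →g skeleton r n}
    (hf : P.IsCellHom r n f) : ∃ M, P.IsDevelopment r n M fun v => (f v).1 := by
  have hr := h.three_le
  choose! g hg hgf using hf.map_face
  have hpos : ∀ d ∈ P.bounded, ∀ i : ℕ, (f ((P.next ^ i) d).fst).1 =
      (g d * faceRotation r) *ᵥ corner r n (i - 1) := by
    intro d hd i
    have h1 := faceRotation_pow_mulVec_corner (r := r) (q := n) 1 (i - 1)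
    rw [pow_one] at h1
    rw [hgf d hd, baseVertex_eq_corner, ← mulVec_mulVec, h1]
    simp
  have hpos0 : ∀ d ∈ P.bounded, (f d.fst).1 = (g d * faceRotation r) *ᵥ corner r n (-1) := by
    intro d hd
    have := hpos d hd 0
    simpa using this
  have hpos1 : ∀ d ∈ P.bounded, (f d.snd).1 = (g d * faceRotation r) *ᵥ corner r n 0 := by
    intro d hd
    have := hpos d hd 1
    rw [pow_one, P.next_fst] at this
    simpa using this
  have hmem : ∀ d ∈ P.bounded, g d * faceRotation r ∈ symmetries r n := fun d hd =>
    mul_mem (hg d hd) faceRotation_mem_symmetries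
  refine ⟨fun d => g d * faceRotation r, hmem, hpos0, fun d hd => ?_, fun d hd hd' => ?_⟩
  · apply ext_of_corner hr hn
    intro j
    have hr0 : (0 : ℤ) < r := by omega
    have h1 := Int.emod_nonneg (j + 1) hr0.ne'
    have h2 : j = ((((j + 1) % r).toNat : ℤ) - 1) + r * ((j + 1) / r) := by
      have := Int.emod_add_mul_ediv (j + 1) r
      rw [Int.toNat_of_nonneg h1]
      omega
    rw [h2, corner_add_mul_self hr]
    generalize ((j + 1) % (r : ℤ)).toNat = i
    have h3 := hpos _ ((P.bounded_next d).2 hd) i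
    have h4 := hpos d hd (i + 1)
    have h5 := faceRotation_pow_mulVec_corner (r := r) (q := n) 1 (i - 1)
    rw [pow_one] at h5
    rw [← h3, ← Equiv.Perm.mul_apply, ← pow_succ, h4, ← mulVec_mulVec _ (g d * faceRotation r), h5]
    congr 2
    push_cast
    ring
  · obtain ⟨u1, j1⟩ := isUnit_and_mul_diagonal_mul_of_mem_symmetries (hmem d hd)
    obtain ⟨-, j2⟩ := isUnit_and_mul_diagonal_mul_of_mem_symmetries (hmem _ hd')
    have p0 := hpos0 d hd
    have p1 := hpos1 d hd
    have p0' := hpos0 _ hd'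
    have p1' := hpos1 _ hd'
    have hi := h.image_faceVerts (pos := fun v => (f v).1) hd (hpos d hd)
    have hi' := h.image_faceVerts (pos := fun v => (f v).1) hd' (hpos _ hd')
    generalize g d * faceRotation r = A at *
    generalize g d.symm * faceRotation r = B at *
    have udet := (isUnit_iff_isUnit_det _).1 u1
    have hB : A * (A⁻¹ * B) = B := by rw [← mul_assoc, mul_nonsing_inv _ udet, one_mul]
    have hJ : A⁻¹ * B * Matrix.diagonal ![1, 1, curvature r n] * (A⁻¹ * B)ᵀ =
        Matrix.diagonal ![1, 1, curvature r n] := by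
      set J := Matrix.diagonal ![1, 1, curvature r n]
      rw [transpose_mul]
      calc A⁻¹ * B * J * (Bᵀ * A⁻¹ᵀ) = A⁻¹ * (B * J * Bᵀ) * A⁻¹ᵀ := by simp only [mul_assoc]
        _ = A⁻¹ * (A * J * Aᵀ) * A⁻¹ᵀ := by rw [j1, j2]
        _ = (A⁻¹ * A) * J * (A⁻¹ * A)ᵀ := by rw [transpose_mul]; simp only [mul_assoc]
        _ = J := by rw [nonsing_inv_mul _ udet]; simp
    have hinv : ∀ y, A⁻¹ *ᵥ (A *ᵥ y) = y := fun y => by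
      rw [mulVec_mulVec, nonsing_inv_mul _ udet, one_mulVec]
    rcases eq_halfTurn_or_eq_flip hr hn hJ
      (by rw [← mulVec_mulVec, ← p0']; change A⁻¹ *ᵥ (f d.snd).1 = _; rw [p1, hinv])
      (by rw [← mulVec_mulVec, ← p1']; change A⁻¹ *ᵥ (f d.fst).1 = _; rw [p0, hinv]) with hA | hA
    · rw [← hA, hB]
    · exfalso
      apply hf.not_folded d hd hd'
      apply Subtype.val_injective.image_injective
      rw [Set.image_image, Set.image_image, hi, hi']
      rw [hA] at hB
      ext x
      constructor
      · rintro ⟨j, rfl⟩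
        refine ⟨-1 - j, ?_⟩
        dsimp only
        rw [← hB, ← mulVec_mulVec, flip_mulVec_corner]
        congr 2
        ring
      · rintro ⟨j, rfl⟩
        refine ⟨-1 - j, ?_⟩
        dsimp only
        rw [← hB, ← mulVec_mulVec, flip_mulVec_corner]

end PlaneMap

/-! ## Injectivity of developments -/

namespace PlaneMap

open RegularPartition Matrix

variable {V : Type u} {G : SimpleGraph V} {P : PlaneMap G} {r q n : ℕ}

theorem next_pow_symm_snd (d : G.Dart) (i : ℕ) :
    ((P.next ^ i) d).symm.fst = ((P.next ^ (i + 1)) d).fst := by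
  rw [pow_succ', Equiv.Perm.mul_apply, P.next_fst]
  rfl

namespace IsDevelopment

variable {M : G.Dart → Matrix (Fin 3) (Fin 3) ℝ} {pos : V → Fin 3 → ℝ}

/-- Only the vertices newly added by a step of a chain must be kept apart from the first face: the
ends of the entering edge, which are the vertices with `k < 2`, already belong to the previous face.
-/
theorem pos_injective_of_separated (h : P.IsOuterplanarRealization r q) (hn : 3 ≤ n)
    (D : P.IsDevelopment r n M pos)
    (hsep : ∀ a d s t i, P.FaceChain r a d s t → 1 ≤ i → i < r →
      ((P.next ^ i) d).symm ∈ P.bounded → ∀ v ∈ P.faceVerts a, ∀ k : ℕ, 2 ≤ k → k < r →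
        (M ((P.next ^ i) d).symm)⁻¹ *ᵥ pos v ≠ corner r n (k - 1)) :
    Function.Injective pos := by
  have hr := h.three_le
  have key : ∀ a d s t, P.FaceChain r a d s t → ∀ v ∈ P.faceVerts a, ∀ w ∈ P.faceVerts d,
      pos v = pos w → v = w := by
    intro a d s t H
    induction H with
    | single ha =>
      rintro _ ⟨d₁, h1, rfl⟩ _ ⟨d₂, h2, rfl⟩ he
      obtain ⟨i, hi, rfl⟩ := h.exists_next_pow_eq ha h1
      obtain ⟨j, hj, rfl⟩ := h.exists_next_pow_eq ha h2
      rw [D.pos_next_pow ha, D.pos_next_pow ha] at he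
      have he := congrArg (fun y => (M a)⁻¹ *ᵥ y) he
      simp only [D.inv_mulVec_mulVec ha] at he
      have := corner_injective_of_lt hr hn (by omega) (by omega) he
      obtain rfl : i = j := by omega
      rfl
    | @step d s t i H h1 hi hb ih =>
      rintro v hv _ ⟨d₂, h2, rfl⟩ he
      obtain ⟨k, hk, rfl⟩ := h.exists_next_pow_eq hb h2
      by_cases hk2 : 2 ≤ k
      · have hsep := hsep a d s t i H h1 hi hb v hv k hk2 hk
        rw [he, D.pos_next_pow hb, D.inv_mulVec_mulVec hb] at hsep
        exact absurd rfl hsep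
      · apply ih v hv _ _ he
        have h01 : k = 0 ∨ k = 1 := by omega
        rcases h01 with rfl | rfl
        · exact ⟨_, ⟨(i + 1 : ℕ), by rw [zpow_natCast]⟩, (next_pow_symm_snd d i).symm⟩
        · refine ⟨(P.next ^ i) d, ⟨i, by rw [zpow_natCast]⟩, ?_⟩
          rw [pow_one, P.next_fst]
          rfl
  intro v w he
  obtain ⟨d₁, h1, rfl⟩ := h.exists_bounded v
  obtain ⟨d₂, h2, rfl⟩ := h.exists_bounded w
  obtain ⟨a, d, s, t, H, ha, hd⟩ := h.exists_faceChain h1 h2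
  exact key a d s t H _ ⟨d₁, ha.symm, rfl⟩ _ ⟨d₂, hd, rfl⟩ he

end IsDevelopment

end PlaneMap

/-! ## Developments into `(r^{2q-2})` -/

namespace RegularPartition

open Real Matrix

variable {r n : ℕ}

/-- By `nonneg_of_trig_polygon`, the functional of edge `j` is a nonnegative combination of those of
the edges `±1` and the negative of that of edge `0`. -/
theorem edgeFun_nonneg_of_nonneg (hr : 3 ≤ r) {y : Fin 3 → ℝ} (h0 : edgeFun r n 0 y ≤ 0)
    (h1 : 0 ≤ edgeFun r n 1 y) (h2 : 0 ≤ edgeFun r n (-1) y) {j : ℤ} (hj : 1 ≤ j) (hjr : j < r) :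
    0 ≤ edgeFun r n j y := by
  have hr0 : (0 : ℝ) < r := by norm_cast; omega
  have hr3 : (3 : ℝ) ≤ r := by exact_mod_cast hr
  have hθ : 0 < π / r := by positivity
  have hrθ : r * (π / r) = π := by field_simp
  have hj' : (1 : ℝ) ≤ j := by exact_mod_cast hj
  have hjr' : (j : ℝ) + 1 ≤ r := by exact_mod_cast hjr
  obtain ⟨a, b, c, ha, hb, hc, habc, hcos, hsin⟩ := nonneg_of_trig_polygon (β := 2 * (π / r))
    (φ := 2 * j * (π / r)) (by positivity) (by nlinarith) (by nlinarith) (by nlinarith)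
  have key : edgeFun r n j y =
      a * edgeFun r n 1 y + b * edgeFun r n (-1) y - c * edgeFun r n 0 y := by
    simp only [edgeFun, hcos, hsin]
    push_cast
    simp only [mul_one, mul_neg, neg_mul, cos_neg, sin_neg, mul_zero, zero_mul, cos_zero, sin_zero]
    linear_combination -(sin (π / r) * sin (π / n) * y 2) * habc
  rw [key]
  nlinarith [mul_nonneg ha h1, mul_nonneg hb h2, mul_nonneg hc (neg_nonneg.2 h0)]

/-- The conditions, in terms of the position `y` relative to the last face of a chain of faces, that
the chain stays on one side of certain lines through the end points of the edge through which the
last face is entered; `π / m` is the angle of the faces, and `s`, `t` are the numbers of last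
faces of the chain meeting at the two end points. -/
structure InHalfPlanes (r n m s t : ℕ) (y : Fin 3 → ℝ) : Prop where
  nonneg : ∀ j : ℤ, 1 ≤ j → j < r → 0 ≤ edgeFun r n j y
  left : ∀ k : ℕ, k + s ≤ m →
    0 ≤ sin ((k + 1) * (π / m)) * edgeFun r n 1 y + sin (k * (π / m)) * edgeFun r n 0 y
  right : ∀ k : ℕ, k + t ≤ m →
    0 ≤ sin ((k + 1) * (π / m)) * edgeFun r n (-1) y + sin (k * (π / m)) * edgeFun r n 0 y

theorem sin_mul_pi_div_nonneg {k m : ℕ} (h : k ≤ m) : 0 ≤ sin (k * (π / m)) := by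
  apply sin_nonneg_of_nonneg_of_le_pi (by positivity)
  rcases Nat.eq_zero_or_pos m with rfl | hm
  · simp [pi_pos.le]
  · have h' : (k : ℝ) ≤ m := by exact_mod_cast h
    have hm' : (0 : ℝ) < m := by exact_mod_cast hm
    calc k * (π / m) ≤ m * (π / m) := by gcongr
      _ = π := by field_simp

theorem sin_succ_mul_pi_div_nonneg {k m : ℕ} (h : k + 1 ≤ m) : 0 ≤ sin ((k + 1) * (π / m)) := by
  have := sin_mul_pi_div_nonneg h
  push_cast at this
  exact this

theorem InHalfPlanes.of_nonneg {m s t : ℕ} {y : Fin 3 → ℝ} (hy : ∀ j, 0 ≤ edgeFun r n j y)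
    (hs : 1 ≤ s) (ht : 1 ≤ t) : InHalfPlanes r n m s t y where
  nonneg j _ _ := hy j
  left k hk := add_nonneg (mul_nonneg (sin_succ_mul_pi_div_nonneg (by omega)) (hy _))
    (mul_nonneg (sin_mul_pi_div_nonneg (by omega)) (hy _))
  right k hk := add_nonneg (mul_nonneg (sin_succ_mul_pi_div_nonneg (by omega)) (hy _))
    (mul_nonneg (sin_mul_pi_div_nonneg (by omega)) (hy _))

theorem step_coeff_one (hr : 3 ≤ r) : 2 * cos (π / n) ^ 2 * (1 - cos (2 * (π / r))) /
    sin (π / r) ^ 2 - 2 = 2 * cos (2 * (π / n)) := by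
  have hs := (sin_pi_div_pos (n := r) (by omega)).ne'
  have h1 := sin_sq_add_cos_sq (π / r)
  rw [cos_two_mul, cos_two_mul, show cos (π / r) ^ 2 = 1 - sin (π / r) ^ 2 by linarith]
  field_simp
  ring

/-- With `α = π / m`, the recursion `sin ((k + 2) α) = 2 cos α sin ((k + 1) α) - sin (k α)` turns
condition `k` at the new face into condition `k + 1` at the old one whenever the same vertex is
kept. At a fresh vertex it becomes a nonnegative combination of functionals already known to be
nonnegative. The conditions `k = 0` give the edges `±1`, and these give the remaining edges. -/
theorem InHalfPlanes.step (hr : 3 ≤ r) {m s t i : ℕ} (hm : 2 ≤ m) (hn : n = 2 * m)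
    {y w : Fin 3 → ℝ} (hy : InHalfPlanes r n m s t y) (h1 : 1 ≤ i) (hi : i < r)
    (hw : ∀ j : ℤ, edgeFun r n j w = edgeFun r n (i - j) y +
      (2 * cos (π / n) ^ 2 * (1 - cos (2 * j * (π / r))) / sin (π / r) ^ 2 - 2) *
        edgeFun r n i y)
    (hs' : (if i = 1 then s + 1 else 2) ≤ m) (ht' : (if i + 1 = r then t + 1 else 2) ≤ m) :
    InHalfPlanes r n m (if i = 1 then s + 1 else 2) (if i + 1 = r then t + 1 else 2) w := by
  have hang : 2 * (π / n) = π / m := by rw [hn]; push_cast; field_simp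
  have hm0 : (0 : ℝ) < m := by norm_cast; omega
  have hsinα : 0 < sin (π / m) := sin_pi_div_pos hm
  have hw0 : edgeFun r n 0 w = - edgeFun r n i y := by
    have := hw 0
    simp at this
    linarith
  have hw1 : edgeFun r n 1 w = edgeFun r n (i - 1) y + 2 * cos (π / m) * edgeFun r n i y := by
    have h2 := hw 1
    have h3 := step_coeff_one (n := n) hr
    rw [Int.cast_one, mul_one, h3, hang] at h2
    exact h2
  have hw2 : edgeFun r n (-1) w =
      edgeFun r n (i + 1) y + 2 * cos (π / m) * edgeFun r n i y := by
    have h2 := hw (-1)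
    have h3 := step_coeff_one (n := n) hr
    rw [Int.cast_neg, Int.cast_one, mul_neg, mul_one, neg_mul, cos_neg, h3, hang,
      sub_neg_eq_add] at h2
    exact h2
  have hEi := hy.nonneg i (by omega) (by omega)
  have htrig : ∀ k : ℕ, 2 * cos (π / m) * sin ((k + 1) * (π / m)) - sin (k * (π / m)) =
      sin (((k + 1 : ℕ) + 1) * (π / m)) := by
    intro k
    have e1 : (((k + 1 : ℕ) : ℝ) + 1) * (π / m) = (k + 1) * (π / m) + π / m := by push_cast; ring
    have e2 : (k : ℝ) * (π / m) = (k + 1) * (π / m) - π / m := by ring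
    rw [e1, e2, sin_add, sin_sub]
    ring
  have hleft : ∀ k : ℕ, k + (if i = 1 then s + 1 else 2) ≤ m →
      0 ≤ sin ((k + 1) * (π / m)) * edgeFun r n 1 w + sin (k * (π / m)) * edgeFun r n 0 w := by
    intro k hk
    have e : sin ((k + 1) * (π / m)) * edgeFun r n 1 w + sin (k * (π / m)) * edgeFun r n 0 w =
        sin (((k + 1 : ℕ) + 1) * (π / m)) * edgeFun r n i y +
          sin ((k + 1 : ℕ) * (π / m)) * edgeFun r n (i - 1) y := by
      rw [hw0, hw1, ← htrig]
      push_cast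
      ring
    rw [e]
    split_ifs at hk with hi1
    · have := hy.left (k + 1) (by omega)
      subst hi1
      simpa using this
    · exact add_nonneg (mul_nonneg (sin_succ_mul_pi_div_nonneg (by omega)) hEi)
        (mul_nonneg (sin_mul_pi_div_nonneg (by omega)) (hy.nonneg _ (by omega) (by omega)))
  have hright : ∀ k : ℕ, k + (if i + 1 = r then t + 1 else 2) ≤ m →
      0 ≤ sin ((k + 1) * (π / m)) * edgeFun r n (-1) w + sin (k * (π / m)) * edgeFun r n 0 w := by
    intro k hk
    have e : sin ((k + 1) * (π / m)) * edgeFun r n (-1) w + sin (k * (π / m)) * edgeFun r n 0 w =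
        sin (((k + 1 : ℕ) + 1) * (π / m)) * edgeFun r n i y +
          sin ((k + 1 : ℕ) * (π / m)) * edgeFun r n (i + 1) y := by
      rw [hw0, hw2, ← htrig]
      push_cast
      ring
    rw [e]
    split_ifs at hk with hi1
    · have := hy.right (k + 1) (by omega)
      rw [← edgeFun_add_self hr, ← edgeFun_add_self hr 0] at this
      rw [show (i : ℤ) = -1 + r by omega, show (-1 : ℤ) + r + 1 = 0 + r by omega]
      exact this
    · exact add_nonneg (mul_nonneg (sin_succ_mul_pi_div_nonneg (by omega)) hEi)
        (mul_nonneg (sin_mul_pi_div_nonneg (by omega)) (hy.nonneg _ (by omega) (by omega)))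
  have h1w : 0 ≤ edgeFun r n 1 w := by
    have := hleft 0 (by omega)
    simp only [Nat.cast_zero, zero_add, one_mul, zero_mul, sin_zero, add_zero] at this
    exact nonneg_of_mul_nonneg_right this hsinα
  have h2w : 0 ≤ edgeFun r n (-1) w := by
    have := hright 0 (by omega)
    simp only [Nat.cast_zero, zero_add, one_mul, zero_mul, sin_zero, add_zero] at this
    exact nonneg_of_mul_nonneg_right this hsinα
  exact ⟨fun j hj hjr => edgeFun_nonneg_of_nonneg hr (by linarith) h1w h2w hj hjr, hleft, hright⟩

end RegularPartition

namespace PlaneMap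

open RegularPartition Matrix

variable {V : Type u} {G : SimpleGraph V} {P : PlaneMap G} {r q n : ℕ}

namespace IsDevelopment

variable {M : G.Dart → Matrix (Fin 3) (Fin 3) ℝ} {pos : V → Fin 3 → ℝ}

/-- Here `m = q - 1` is at once the number of faces in a straight angle and, by `lt_degree`, a bound
for the number of faces of the chain at a vertex. -/
theorem inHalfPlanes (h : P.IsOuterplanarRealization r q) (hq : 3 ≤ q)
    (D : P.IsDevelopment r (2 * q - 2) M pos) {a d : G.Dart} {s t : ℕ}
    (H : P.FaceChain r a d s t) {x : Fin 3 → ℝ}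
    (hx : ∀ j, 0 ≤ edgeFun r (2 * q - 2) j ((M a)⁻¹ *ᵥ x)) :
    InHalfPlanes r (2 * q - 2) (q - 1) s t ((M d)⁻¹ *ᵥ x) := by
  induction H with
  | single ha => exact .of_nonneg hx le_rfl le_rfl
  | @step d s t i H h1 hi hb ih =>
    obtain ⟨hs, ht⟩ := (H.step i h1 hi hb).lt_degree h
    exact ih.step h.three_le (by omega) (by omega) h1 hi
      (D.edgeFun_step h.three_le (by omega) H.mem_bounded hb x) (by omega) (by omega)

theorem edgeFun_zero_nonpos (h : P.IsOuterplanarRealization r q) (hq : 3 ≤ q)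
    (D : P.IsDevelopment r (2 * q - 2) M pos) {a d : G.Dart} {s t i : ℕ}
    (H : P.FaceChain r a d s t) (h1 : 1 ≤ i) (hi : i < r) (hb : ((P.next ^ i) d).symm ∈ P.bounded)
    {x : Fin 3 → ℝ} (hx : ∀ j, 0 ≤ edgeFun r (2 * q - 2) j ((M a)⁻¹ *ᵥ x)) :
    edgeFun r (2 * q - 2) 0 ((M ((P.next ^ i) d).symm)⁻¹ *ᵥ x) ≤ 0 := by
  have h2 := D.edgeFun_step h.three_le (by omega) H.mem_bounded hb x 0
  have h3 := (D.inHalfPlanes h hq H hx).nonneg i (by omega) (by omega)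
  simp at h2
  linarith

theorem edgeFun_inv_mulVec_pos_nonneg (h : P.IsOuterplanarRealization r q) (hn : 3 ≤ n)
    (D : P.IsDevelopment r n M pos) {a : G.Dart} (ha : a ∈ P.bounded) {v : V}
    (hv : v ∈ P.faceVerts a) (j : ℤ) : 0 ≤ edgeFun r n j ((M a)⁻¹ *ᵥ pos v) := by
  obtain ⟨d, hd, rfl⟩ := hv
  obtain ⟨i, -, rfl⟩ := h.exists_next_pow_eq ha hd
  rw [D.pos_next_pow ha, D.inv_mulVec_mulVec ha]
  exact edgeFun_corner_nonneg h.three_le hn _ _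

theorem _root_.PlaneMap.FaceChain.start_mem_bounded {a d : G.Dart} {s t : ℕ}
    (H : P.FaceChain r a d s t) : a ∈ P.bounded := by
  induction H with
  | single ha => exact ha
  | step _ _ _ _ _ ih => exact ih

/-- The first face lies weakly behind the edge through which the last face is entered, while the new
vertices lie strictly in front of it. -/
theorem pos_injective (h : P.IsOuterplanarRealization r q) (hq : 3 ≤ q)
    (D : P.IsDevelopment r (2 * q - 2) M pos) : Function.Injective pos := by
  refine D.pos_injective_of_separated h (by omega) ?_
  intro a d s t i H h1 hi hb v hv k hk hkr he
  have h2 := D.edgeFun_zero_nonpos h hq H h1 hi hb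
    (D.edgeFun_inv_mulVec_pos_nonneg h (by omega) H.start_mem_bounded hv)
  rw [he] at h2
  exact absurd (edgeFun_corner_pos h.three_le (by omega) (i := 0) (j := k - 1) (by omega)
    (by omega)) (not_lt.2 h2)

/-- Follow the segment from `x` to `y` backwards along the chain. A point in front of the entering
edge is in the last face, because the other edges of that face do not separate it from `x`. A point
behind it lies between `x` and the crossing with the edge, so the shorter chain suffices. -/
theorem exists_mem_face_of_nonneg_combination (h : P.IsOuterplanarRealization r q) (hq : 3 ≤ q)
    (D : P.IsDevelopment r (2 * q - 2) M pos) {a d : G.Dart} {s t : ℕ}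
    (H : P.FaceChain r a d s t) {x : Fin 3 → ℝ}
    (hx : ∀ j, 0 ≤ edgeFun r (2 * q - 2) j ((M a)⁻¹ *ᵥ x)) :
    ∀ y, (∀ j, 0 ≤ edgeFun r (2 * q - 2) j ((M d)⁻¹ *ᵥ y)) → ∀ u v : ℝ, 0 ≤ u → 0 ≤ v →
      ∃ d' ∈ P.bounded, ∀ j, 0 ≤ edgeFun r (2 * q - 2) j ((M d')⁻¹ *ᵥ (u • x + v • y)) := by
  have hr := h.three_le
  have hn : 3 ≤ 2 * q - 2 := by omega
  have hlin : ∀ (A : Matrix (Fin 3) (Fin 3) ℝ) (u v : ℝ) (x y : Fin 3 → ℝ) (j : ℤ),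
      edgeFun r (2 * q - 2) j (A *ᵥ (u • x + v • y)) =
        u * edgeFun r (2 * q - 2) j (A *ᵥ x) + v * edgeFun r (2 * q - 2) j (A *ᵥ y) := by
    intro A u v x y j
    rw [mulVec_add, mulVec_smul, mulVec_smul, edgeFun_add, edgeFun_smul, edgeFun_smul]
  induction H with
  | single ha =>
    intro y hy u v hu hv
    refine ⟨_, ha, fun j => ?_⟩
    rw [hlin]
    exact add_nonneg (mul_nonneg hu (hx j)) (mul_nonneg hv (hy j))
  | @step d s t i H h1 hi hb ih =>
    intro y hy u v hu hv
    have hd := H.mem_bounded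
    have hx' := (D.inHalfPlanes h hq (H.step i h1 hi hb) hx).nonneg
    have hx0 := D.edgeFun_zero_nonpos h hq H h1 hi hb hx
    have hall : ∀ z, 0 ≤ edgeFun r (2 * q - 2) 0 ((M ((P.next ^ i) d).symm)⁻¹ *ᵥ z) →
        (∀ j : ℤ, 1 ≤ j → j < r →
          0 ≤ edgeFun r (2 * q - 2) j ((M ((P.next ^ i) d).symm)⁻¹ *ᵥ z)) →
        ∀ j, 0 ≤ edgeFun r (2 * q - 2) j ((M ((P.next ^ i) d).symm)⁻¹ *ᵥ z) := by
      intro z hz0 hz j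
      have hr0 : (0 : ℤ) < r := by omega
      have e1 := Int.emod_nonneg j hr0.ne'
      have e2 := Int.emod_lt_of_pos j hr0
      rw [← Int.emod_add_mul_ediv j r, edgeFun_add_mul_self hr]
      rcases eq_or_lt_of_le e1 with e1 | e1
      · rw [← e1]; exact hz0
      · exact hz _ e1 e2
    by_cases hz : 0 ≤ edgeFun r (2 * q - 2) 0 ((M ((P.next ^ i) d).symm)⁻¹ *ᵥ (u • x + v • y))
    · refine ⟨_, hb, hall _ hz fun j hj hjr => ?_⟩
      rw [hlin]
      exact add_nonneg (mul_nonneg hu (hx' j hj hjr)) (mul_nonneg hv (hy j))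
    · rw [hlin] at hz
      push Not at hz
      set ex := edgeFun r (2 * q - 2) 0 ((M ((P.next ^ i) d).symm)⁻¹ *ᵥ x) with hex
      set ey := edgeFun r (2 * q - 2) 0 ((M ((P.next ^ i) d).symm)⁻¹ *ᵥ y) with hey
      have hy0 : 0 ≤ ey := hy 0
      have hexneg : ex < 0 := by
        refine lt_of_le_of_ne hx0 fun h0 => ?_
        rw [h0, mul_zero, zero_add] at hz
        exact absurd (mul_nonneg hv hy0) (not_le.2 hz)
      -- The point, up to a positive factor, where the segment crosses the line of the entering
      -- edge. It lies on the edge itself, hence also in the previous face.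
      set p := ey • x + (-ex) • y with hp
      have hp0 : edgeFun r (2 * q - 2) 0 ((M ((P.next ^ i) d).symm)⁻¹ *ᵥ p) = 0 := by
        rw [hp, hlin, ← hex, ← hey]; ring
      have hpj : ∀ j, 0 ≤ edgeFun r (2 * q - 2) j ((M ((P.next ^ i) d).symm)⁻¹ *ᵥ p) := by
        apply hall _ hp0.ge
        intro j hj hjr
        rw [hp, hlin]
        exact add_nonneg (mul_nonneg hy0 (hx' j hj hjr)) (mul_nonneg (by linarith) (hy j))
      obtain ⟨α, β, hα, hβ, hαβ⟩ := exists_nonneg_corner_add_corner hr hn hp0 (hpj 1) (hpj (-1))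
      have hpd : ∀ j, 0 ≤ edgeFun r (2 * q - 2) j ((M d)⁻¹ *ᵥ p) := by
        intro j
        rw [← D.mulVec_inv_mulVec hb p, hαβ, mulVec_add, mulVec_smul, mulVec_smul,
          ← D.pos_eq _ hb, ← D.pos_snd hb, hlin, next_pow_symm_snd]
        change 0 ≤ α * _ + β * edgeFun r (2 * q - 2) j ((M d)⁻¹ *ᵥ pos ((P.next ^ i) d).fst)
        rw [D.pos_next_pow hd, D.pos_next_pow hd, D.inv_mulVec_mulVec hd,
          D.inv_mulVec_mulVec hd]
        exact add_nonneg (mul_nonneg hα (edgeFun_corner_nonneg hr hn _ _))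
          (mul_nonneg hβ (edgeFun_corner_nonneg hr hn _ _))
      have hcomb : u • x + v • y = ((u * -ex - v * ey) / -ex) • x + (v / -ex) • p := by
        have : ex ≠ 0 := hexneg.ne
        ext k
        simp only [hp, Pi.add_apply, Pi.smul_apply, smul_eq_mul]
        field_simp
        ring
      rw [hcomb]
      have hnex : 0 < -ex := by linarith
      exact ih p hpd _ _ (div_nonneg (by linarith) hnex.le) (div_nonneg hv hnex.le)

end IsDevelopment

end PlaneMap

/-! ## Developments into `(3^{q+2})` -/

namespace RegularPartition

open Real Matrix

/-- In barycentric coordinates with respect to a triangle with angles `α` (`p` is the coordinate of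
the vertex `u`), the linear functionals arising by rotation around `u` from the one that vanishes
on the line through the midpoints of the sides of the triangle at `u`; `φ` is the angle of
rotation. -/
noncomputable def midlineFun (α φ p a b : ℝ) : ℝ :=
  p + a * ((cos α - cos φ) / (1 - cos α) - sin φ / sin α) +
    b * ((cos α - cos φ) / (1 - cos α) + sin φ / sin α)

variable {α : ℝ}

theorem midlineFun_swap (α φ p a b : ℝ) :
    midlineFun α φ p b a = midlineFun α (2 * π - φ) p a b := by
  simp only [midlineFun, cos_two_pi_sub, sin_two_pi_sub]
  ring

/-- On the right are the coordinates in the adjacent triangle across the side opposite to `b`. A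
rotation by `α` around the common vertex carries one triangle to the other. -/
theorem midlineFun_add (hα : sin α ≠ 0) (φ p a b : ℝ) :
    midlineFun α (φ + α) p a b =
      midlineFun α φ (p + 2 * cos α * b) (-b) (a + 2 * cos α * b) := by
  have h1 := sin_sq_add_cos_sq α
  have h2 : 1 - cos α ≠ 0 := by
    intro h
    have : sin α ^ 2 = 0 := by rw [show cos α = 1 by linarith] at h1; linarith
    exact hα (pow_eq_zero_iff (two_ne_zero) |>.1 this)
  simp only [midlineFun, cos_add, sin_add]
  field_simp
  have h3 : sin α ^ 2 = 1 - cos α ^ 2 := by linarith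
  ring_nf
  simp only [h3]
  ring

/-- In the coordinates of the adjacent triangle opposite to `b` this is the sum of the coordinates
of the two common vertices minus that of the apex: it vanishes on the midline that cuts off the
apex. -/
theorem midlineFun_two_mul (hα : sin α ≠ 0) (p a b : ℝ) :
    midlineFun α (2 * α) p a b = p + a + (4 * cos α + 1) * b := by
  have h1 := sin_sq_add_cos_sq α
  have h2 : 1 - cos α ≠ 0 := by
    intro h
    have : sin α ^ 2 = 0 := by rw [show cos α = 1 by linarith] at h1; linarith
    exact hα (pow_eq_zero_iff (two_ne_zero) |>.1 this)
  simp only [midlineFun, cos_two_mul, sin_two_mul]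
  field_simp
  ring

/-- `h1` and `h2` are the values at the angles `±2α`, and `h3` says that the value at `0` is
negative; `nonneg_of_trig_polygon` covers the angles between. -/
theorem midlineFun_pos_of_pos (h0 : 0 < α) (hπ : 2 * α < π) {p a b φ : ℝ}
    (h1 : 0 < p + a + (4 * cos α + 1) * b) (h2 : 0 < p + b + (4 * cos α + 1) * a)
    (h3 : p < a + b) (hφ : 2 * α ≤ φ) (hφ' : φ ≤ 2 * π - 2 * α) : 0 < midlineFun α φ p a b := by
  have hα : sin α ≠ 0 := (sin_pos_of_pos_of_lt_pi h0 (by linarith)).ne'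
  obtain ⟨x, y, z, hx, hy, hz, hxyz, hcos, hsin⟩ :=
    nonneg_of_trig_polygon (β := 2 * α) (by linarith) hπ hφ hφ'
  have e1 := midlineFun_two_mul hα p a b
  have e2 := midlineFun_two_mul hα p b a
  rw [midlineFun_swap] at e2
  have hc : 1 - cos α ≠ 0 := by
    intro h
    have h1 := sin_sq_add_cos_sq α
    have : sin α ^ 2 = 0 := by rw [show cos α = 1 by linarith] at h1; linarith
    exact hα (pow_eq_zero_iff (two_ne_zero) |>.1 this)
  have key : midlineFun α φ p a b = x * (p + a + (4 * cos α + 1) * b) +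
      y * (p + b + (4 * cos α + 1) * a) + z * (a + b - p) := by
    rw [← e1, ← e2]
    simp only [midlineFun, hcos, hsin, cos_two_pi_sub, sin_two_pi_sub]
    field_simp
    obtain rfl : z = x + y - 1 := by linarith
    ring
  rw [key]
  have h4 : 0 < x ∨ 0 < y := by
    by_contra! h
    linarith [h.1, h.2]
  rcases h4 with h4 | h4
  · nlinarith [mul_pos h4 h1, mul_nonneg hy h2.le, mul_nonneg hz (show 0 ≤ a + b - p by linarith)]
  · nlinarith [mul_pos h4 h2, mul_nonneg hx h1.le, mul_nonneg hz (show 0 ≤ a + b - p by linarith)]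

theorem midlineFun_coeff_pos (h0 : 0 < α) (hπ : α < π) {φ : ℝ} (hφ : 2 * α ≤ φ)
    (hφ' : φ ≤ 2 * π - 2 * α) : 0 < (cos α - cos φ) / (1 - cos α) + sin φ / sin α := by
  obtain ⟨β, rfl⟩ : ∃ β, α = 2 * β := ⟨α / 2, by ring⟩
  have hs : 0 < sin β := sin_pos_of_pos_of_lt_pi (by linarith) (by linarith)
  have hc : 0 < cos β := cos_pos_of_mem_Ioo ⟨by linarith, by linarith⟩
  have h1 := sin_sq_add_cos_sq β
  -- With half angles the coefficient is a positive multiple of `cos (2β) cos β - cos (φ + β)`, and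
  -- `cos (3β) < cos (2β) cos β`.
  have h2 : cos (φ + β) ≤ cos (3 * β) :=
    cos_le_cos_of_le_of_le_two_pi_sub (by linarith) (by linarith) (by linarith)
  have h3 : cos (3 * β) = cos (2 * β) * cos β - sin (2 * β) * sin β := by
    rw [← cos_add]; congr 1; ring
  have h4 : 1 - cos (2 * β) = 2 * sin β ^ 2 := by rw [cos_two_mul']; linarith
  have h5 : (cos (2 * β) - cos φ) / (1 - cos (2 * β)) + sin φ / sin (2 * β) =
      (cos (2 * β) * cos β - cos (φ + β)) / (2 * sin β ^ 2 * cos β) := by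
    rw [h4, sin_two_mul, cos_add]
    field_simp
    ring
  rw [h5]
  apply div_pos _ (by positivity)
  have : 0 < sin (2 * β) * sin β := by rw [sin_two_mul]; positivity
  linarith

/-- The conditions, in terms of the barycentric coordinates `a`, `b`, `c` of a vertex relative
to the last triangle of a chain of triangles (up to a common factor; the last triangle is entered
through the edge opposite to the vertex with coordinate `a`), that the chain stays on one side of
the midlines of certain triangles at the vertices of the last one. The angles are `2π/n`, and `s`, `t`
are the numbers of last triangles of the chain meeting at the vertices with coordinates `c` and
`b`. -/
structure InMidlineHalfPlanes (n s t : ℕ) (a b c : ℝ) : Prop where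
  left : ∀ j : ℕ, 2 ≤ j → j + s + 1 ≤ n → 0 < midlineFun (2 * (π / n)) (j * (2 * (π / n))) c a b
  right : ∀ j : ℕ, 2 ≤ j → j + t + 1 ≤ n → 0 < midlineFun (2 * (π / n)) (j * (2 * (π / n))) b a c
  apex : ∀ j : ℕ, 2 ≤ j → j + 2 ≤ n → 0 < midlineFun (2 * (π / n)) (j * (2 * (π / n))) a b c

theorem two_pi_sub_mul {n j : ℕ} (hj : j ≤ n) (hn : n ≠ 0) :
    2 * π - j * (2 * (π / n)) = (n - j : ℕ) * (2 * (π / n)) := by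
  have : (n : ℝ) ≠ 0 := by exact_mod_cast hn
  rw [Nat.cast_sub hj]
  field_simp

theorem sin_two_mul_pi_div_ne_zero {n : ℕ} (hn : 5 ≤ n) : sin (2 * (π / n)) ≠ 0 := by
  rw [sin_two_mul]
  have h1 := sin_pi_div_pos (n := n) (by omega)
  have h2 := cos_pi_div_pos (n := n) (by omega)
  positivity

theorem angle_bounds {n j : ℕ} (hn : 5 ≤ n) (h1 : 2 ≤ j) (h2 : j + 2 ≤ n) :
    0 < 2 * (π / n) ∧ 2 * (2 * (π / n)) < π ∧ 2 * (2 * (π / n)) ≤ j * (2 * (π / n)) ∧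
      j * (2 * (π / n)) ≤ 2 * π - 2 * (2 * (π / n)) := by
  have hn0 : (0 : ℝ) < n := by norm_cast; omega
  have hθ : 0 < π / n := by positivity
  have hnθ : n * (π / n) = π := by field_simp
  have hn5 : (5 : ℝ) ≤ n := by exact_mod_cast hn
  have h1' : (2 : ℝ) ≤ j := by exact_mod_cast h1
  have h2' : (j : ℝ) + 2 ≤ n := by exact_mod_cast h2
  refine ⟨by positivity, by nlinarith, by nlinarith, by nlinarith⟩

theorem InMidlineHalfPlanes.swap {n s t : ℕ} (hn : 5 ≤ n) {a b c : ℝ}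
    (h : InMidlineHalfPlanes n s t a b c) : InMidlineHalfPlanes n t s a c b where
  left := h.right
  right := h.left
  apex j hj hjn := by
    rw [midlineFun_swap, two_pi_sub_mul (by omega) (by omega)]
    exact h.apex _ (by omega) (by omega)

/-- The chain leaves through the side opposite to `b`. At the vertex of `c` the old conditions shift
by one angle; at the former apex, the old apex conditions do, read in the opposite sense. The new
apex conditions are interpolated from the extreme ones and from the midline between entering edge
and new apex; this is where `left` with `j = 2` is needed. -/
theorem InMidlineHalfPlanes.step {n s t : ℕ} (hn : 5 ≤ n) {a b c : ℝ}
    (h : InMidlineHalfPlanes n s t a b c) (hs : s + 4 ≤ n) :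
    InMidlineHalfPlanes n (s + 1) 2 (-b) (a + 2 * cos (2 * (π / n)) * b)
      (c + 2 * cos (2 * (π / n)) * b) := by
  have hsin := sin_two_mul_pi_div_ne_zero hn
  have hsucc : ∀ j : ℕ, (j : ℝ) * (2 * (π / n)) + 2 * (π / n) = (j + 1 : ℕ) * (2 * (π / n)) :=
    fun j => by push_cast; ring
  have hleft : ∀ j : ℕ, 2 ≤ j → j + (s + 1) + 1 ≤ n → 0 < midlineFun (2 * (π / n))
      (j * (2 * (π / n))) (c + 2 * cos (2 * (π / n)) * b) (-b) (a + 2 * cos (2 * (π / n)) * b) := by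
    intro j hj hjn
    rw [← midlineFun_add hsin, hsucc]
    exact h.left _ (by omega) (by omega)
  have hright : ∀ j : ℕ, 2 ≤ j → j + 2 + 1 ≤ n → 0 < midlineFun (2 * (π / n))
      (j * (2 * (π / n))) (a + 2 * cos (2 * (π / n)) * b) (-b) (c + 2 * cos (2 * (π / n)) * b) := by
    intro j hj hjn
    rw [← midlineFun_add hsin, hsucc, midlineFun_swap, two_pi_sub_mul (by omega) (by omega)]
    exact h.apex _ (by omega) (by omega)
  refine ⟨hleft, hright, fun j hj hjn => ?_⟩
  obtain ⟨e1, e2, e3, e4⟩ := angle_bounds hn hj hjn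
  have h1 := hright 2 le_rfl (by omega)
  have h2 := hleft 2 le_rfl (by omega)
  have h3 := h.left 2 le_rfl (by omega)
  rw [Nat.cast_ofNat, midlineFun_two_mul hsin] at h1 h2 h3
  exact midlineFun_pos_of_pos e1 e2 (by linarith) (by linarith) (by linarith) e3 e4

/-- In the relevant range of angles all three coefficients of `midlineFun` are positive, so the
closed triangle satisfies the strict inequalities. -/
theorem InMidlineHalfPlanes.of_nonneg {n : ℕ} (hn : 5 ≤ n) {a b c : ℝ}
    (ha : 0 ≤ a) (hb : 0 ≤ b) (hc : 0 ≤ c) (habc : 0 < a + b + c) :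
    InMidlineHalfPlanes n 1 1 a b c := by
  have key : ∀ a b c : ℝ, 0 ≤ a → 0 ≤ b → 0 ≤ c → 0 < a + b + c → ∀ j : ℕ, 2 ≤ j → j + 2 ≤ n →
      0 < midlineFun (2 * (π / n)) (j * (2 * (π / n))) a b c := by
    intro a b c ha hb hc habc j hj hjn
    obtain ⟨e1, e2, e3, e4⟩ := angle_bounds hn hj hjn
    have h1 := midlineFun_coeff_pos e1 (by linarith) e3 e4
    have h2 := midlineFun_coeff_pos e1 (by linarith) (φ := 2 * π - j * (2 * (π / n)))
      (by linarith) (by linarith)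
    rw [cos_two_pi_sub, sin_two_pi_sub, neg_div, ← sub_eq_add_neg] at h2
    rw [midlineFun]
    have hb' := mul_nonneg hb h2.le
    have hc' := mul_nonneg hc h1.le
    rcases eq_or_lt_of_le ha with ha | ha
    · rcases eq_or_lt_of_le hb with hb | hb
      · have hc : 0 < c := by linarith
        linarith [mul_pos hc h1]
      · linarith [mul_pos hb h2]
    · linarith
  exact ⟨fun j hj hjn => key c a b hc ha hb (by linarith) j hj (by omega),
    fun j hj hjn => key b a c hb ha hc (by linarith) j hj (by omega),
    key a b c ha hb hc habc⟩

end RegularPartition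

namespace PlaneMap

open RegularPartition Matrix

variable {V : Type u} {G : SimpleGraph V} {P : PlaneMap G} {q n : ℕ}

namespace IsDevelopment

variable {M : G.Dart → Matrix (Fin 3) (Fin 3) ℝ} {pos : V → Fin 3 → ℝ}

theorem edgeFun_triangle_step (hn : 3 ≤ n) (D : P.IsDevelopment 3 n M pos) {d : G.Dart}
    (hd : d ∈ P.bounded) {i : ℕ} (hi : ((P.next ^ i) d).symm ∈ P.bounded) (x : Fin 3 → ℝ) :
    edgeFun 3 n 0 ((M ((P.next ^ i) d).symm)⁻¹ *ᵥ x) = -edgeFun 3 n i ((M d)⁻¹ *ᵥ x) ∧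
    edgeFun 3 n 1 ((M ((P.next ^ i) d).symm)⁻¹ *ᵥ x) = edgeFun 3 n (i - 1) ((M d)⁻¹ *ᵥ x) +
      2 * Real.cos (2 * (Real.pi / n)) * edgeFun 3 n i ((M d)⁻¹ *ᵥ x) ∧
    edgeFun 3 n 2 ((M ((P.next ^ i) d).symm)⁻¹ *ᵥ x) = edgeFun 3 n (i - 2) ((M d)⁻¹ *ᵥ x) +
      2 * Real.cos (2 * (Real.pi / n)) * edgeFun 3 n i ((M d)⁻¹ *ᵥ x) := by
  have h0 := D.edgeFun_step le_rfl hn hd hi x 0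
  have h1 := D.edgeFun_step le_rfl hn hd hi x 1
  have h2 := D.edgeFun_step le_rfl hn hd hi x 2
  have hc := step_coeff_one (r := 3) (n := n) le_rfl
  have hcos : Real.cos (2 * (2 : ℤ) * (Real.pi / (3 : ℕ))) =
      Real.cos (2 * (Real.pi / (3 : ℕ))) := by
    rw [← Real.cos_two_pi_sub]
    congr 1
    push_cast
    ring
  rw [hcos, hc] at h2
  rw [Int.cast_one, mul_one, hc] at h1
  refine ⟨?_, h1, h2⟩
  simp at h0
  rw [h0]
  ring

theorem inMidlineHalfPlanes (h : P.IsOuterplanarRealization 3 q) (hq : 3 ≤ q)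
    (D : P.IsDevelopment 3 (q + 2) M pos) {a d : G.Dart} {s t : ℕ}
    (H : P.FaceChain 3 a d s t) {v : V} (hv : v ∈ P.faceVerts a) :
    InMidlineHalfPlanes (q + 2) s t (edgeFun 3 (q + 2) 0 ((M d)⁻¹ *ᵥ pos v))
      (edgeFun 3 (q + 2) 1 ((M d)⁻¹ *ᵥ pos v)) (edgeFun 3 (q + 2) 2 ((M d)⁻¹ *ᵥ pos v)) := by
  induction H with
  | single ha =>
    have hnn := D.edgeFun_inv_mulVec_pos_nonneg h (by omega) ha hv
    apply InMidlineHalfPlanes.of_nonneg (by omega) (hnn 0) (hnn 1) (hnn 2)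
    obtain ⟨d, hd, rfl⟩ := hv
    obtain ⟨i, hi, rfl⟩ := h.exists_next_pow_eq ha hd
    have h0 := hnn 0
    have h1 := hnn 1
    have h2 := hnn 2
    rw [D.pos_next_pow ha, D.inv_mulVec_mulVec ha] at h0 h1 h2 ⊢
    have hpos : ∀ k : ℤ, k < i - 1 + 3 → (i : ℤ) - 1 + 3 < k + 3 - 1 →
        0 < edgeFun 3 (q + 2) k (corner 3 (q + 2) (i - 1)) := by
      intro k hk hk'
      rw [← corner_add_self le_rfl]
      exact edgeFun_corner_pos le_rfl (by omega) (by exact_mod_cast hk) (by exact_mod_cast hk')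
    interval_cases i
    · have := hpos 1 (by norm_num) (by norm_num)
      linarith
    · have := hpos 2 (by norm_num) (by norm_num)
      linarith
    · have := edgeFun_corner_pos (r := 3) (q := q + 2) le_rfl (by omega) (i := 0)
        (j := ((2 : ℕ) : ℤ) - 1) (by norm_num) (by norm_num)
      linarith
  | @step d s t i H h1 hi hb ih =>
    obtain ⟨hs, ht⟩ := (H.step i h1 hi hb).lt_degree h
    obtain ⟨e0, e1, e2⟩ := D.edgeFun_triangle_step (by omega) H.mem_bounded hb (pos v)
    rw [e0, e1, e2]
    interval_cases i <;> norm_num at hs ht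
    · have := ih.step (by omega) (by omega)
      rw [if_pos rfl, if_neg (by omega)]
      have e3 := edgeFun_add_self (r := 3) (q := q + 2) le_rfl (-1) ((M d)⁻¹ *ᵥ pos v)
      rw [show (-1 : ℤ) + (3 : ℕ) = 2 by norm_num] at e3
      rw [show ((1 : ℕ) : ℤ) - 1 = 0 by norm_num, show ((1 : ℕ) : ℤ) - 2 = -1 by norm_num, ← e3]
      exact this
    -- Leaving through the remaining edge is the mirror image of the previous case.
    · have := ((ih.swap (by omega)).step (by omega) (by omega)).swap (by omega)
      rw [if_neg (by omega), if_pos rfl]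
      rw [show ((2 : ℕ) : ℤ) - 1 = 1 by norm_num, show ((2 : ℕ) : ℤ) - 2 = 0 by norm_num]
      exact this

/-- The first triangle lies strictly on the near side of the midline that cuts off the apex of the
triangle to be entered, which is condition `j = 2`. It is available because `2 + s + 1 ≤ q + 2`, and
likewise for `t`. -/
theorem pos_injective_of_triangles (h : P.IsOuterplanarRealization 3 q) (hq : 3 ≤ q)
    (D : P.IsDevelopment 3 (q + 2) M pos) : Function.Injective pos := by
  refine D.pos_injective_of_separated h (by omega) ?_
  intro a d s t i H h1 hi hb v hv k hk hkr he
  obtain rfl : k = 2 := by omega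
  obtain ⟨hs, ht⟩ := H.lt_degree h
  have hsin := sin_two_mul_pi_div_ne_zero (n := q + 2) (by omega)
  have hpos := edgeFun_corner_pos (r := 3) (q := q + 2) le_rfl (by omega) (i := 0)
    (j := ((2 : ℕ) : ℤ) - 1) (by norm_num) (by norm_num)
  have hz1 : edgeFun 3 (q + 2) 1 (corner 3 (q + 2) (((2 : ℕ) : ℤ) - 1)) = 0 :=
    edgeFun_corner_self le_rfl (by omega) _
  have hz2 : edgeFun 3 (q + 2) 2 (corner 3 (q + 2) (((2 : ℕ) : ℤ) - 1)) = 0 :=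
    edgeFun_corner_sub_one le_rfl (by omega) _
  obtain ⟨e0, e1, e2⟩ := D.edgeFun_triangle_step (by omega) H.mem_bounded hb (pos v)
  rw [he] at e0 e1 e2
  rw [e0] at hpos
  rw [hz1] at e1
  rw [hz2] at e2
  have hM := D.inMidlineHalfPlanes h hq H hv
  have hl := hM.left 2 le_rfl (by omega)
  have hr := hM.right 2 le_rfl (by omega)
  rw [Nat.cast_ofNat, midlineFun_two_mul hsin] at hl hr
  interval_cases i
  · have e3 := edgeFun_add_self (r := 3) (q := q + 2) le_rfl (-1) ((M d)⁻¹ *ᵥ pos v)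
    rw [show (-1 : ℤ) + (3 : ℕ) = 2 by norm_num] at e3
    rw [show ((1 : ℕ) : ℤ) - 1 = 0 by norm_num] at e1
    rw [show ((1 : ℕ) : ℤ) - 2 = -1 by norm_num, ← e3] at e2
    rw [Nat.cast_one] at *
    linarith
  · rw [show ((2 : ℕ) : ℤ) - 1 = 1 by norm_num] at e1
    rw [show ((2 : ℕ) : ℤ) - 2 = 0 by norm_num] at e2
    rw [Nat.cast_ofNat] at *
    linarith

end IsDevelopment

/-! ## Proper polycycles and convexity -/

/-- The given realization also serves for `n`, since the degree condition on interior vertices is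
vacuous; an injective development embeds the graph. -/
theorem IsOuterplanarRealization.isProperPolycycle {P : PlaneMap G} {r q n : ℕ} (hr : 3 ≤ r)
    (hn : 3 ≤ n) (hqn : q ≤ n) (hG : IsPolycycle r q G) (hP : P.IsPolycyclicRealization r q)
    (ho : P.IsOuterplanar) (hinj : ∀ M pos, P.IsDevelopment r n M pos → Function.Injective pos) :
    IsProperPolycycle r n G := by
  have h := hP.isOuterplanarRealization hr hG ho
  obtain ⟨M, pos, D⟩ := h.exists_isDevelopment hn
  obtain ⟨f, -, hf⟩ := D.exists_hom h hn
  refine ⟨⟨hG.countable, hG.twoConnected, hG.girth_eq,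
    fun v => (hG.degree_le v).trans (by exact_mod_cast hqn), P, fun v hv => absurd hv (ho v),
    hP.rgon, hP.inter⟩, ⟨f, fun v w he => ?_⟩⟩
  apply hinj M pos D
  rw [← hf, ← hf, he]

theorem IsDevelopment.mem_hull_iff {P : PlaneMap G} {r q n : ℕ}
    (h : P.IsOuterplanarRealization r q) (hn : 3 ≤ n) {M : G.Dart → Matrix (Fin 3) (Fin 3) ℝ}
    {pos : V → Fin 3 → ℝ} (D : P.IsDevelopment r n M pos) {d : G.Dart} (hd : d ∈ P.bounded)
    {x : Fin 3 → ℝ} : x ∈ PointedCone.hull ℝ (pos '' P.faceVerts d) ↔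
      ∀ j, 0 ≤ edgeFun r n j ((M d)⁻¹ *ᵥ x) := by
  constructor
  · intro hx j
    induction hx using Submodule.span_induction with
    | mem x hx =>
      obtain ⟨v, hv, rfl⟩ := hx
      exact D.edgeFun_inv_mulVec_pos_nonneg h hn hd hv j
    | zero => simp [edgeFun]
    | add x y _ _ hx hy =>
      rw [mulVec_add, edgeFun_add]
      exact add_nonneg hx hy
    | smul a x _ hx =>
      have : a • x = (a : ℝ) • x := rfl
      rw [this, mulVec_smul, edgeFun_smul]
      exact mul_nonneg a.2 hx
  · intro hx
    rw [← D.mulVec_inv_mulVec hd x]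
    refine mulVec_mem_of_edgeFun_nonneg h.three_le hn (fun j => PointedCone.subset_hull ?_) hx
    rw [h.image_faceVerts hd (D.pos_next_pow hd)]
    exact ⟨j, rfl⟩

theorem IsOuterplanarRealization.isGeodesicallyConvex {P : PlaneMap G} {r q : ℕ}
    (h : P.IsOuterplanarRealization r q) (hq : 3 ≤ q) {f : G →g skeleton r (2 * q - 2)}
    (hf : P.IsCellHom r (2 * q - 2) f) :
    IsGeodesicallyConvex (curvature r (2 * q - 2)) (P.projection f) := by
  have hr := h.three_le
  have hn : 3 ≤ 2 * q - 2 := by omega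
  obtain ⟨M, D⟩ := hf.exists_isDevelopment h hn
  have hmem : ∀ x, x ∈ P.projection f ↔ x ∈ modelPlane (curvature r (2 * q - 2)) ∧
      ∃ d ∈ P.bounded, ∀ j, 0 ≤ edgeFun r (2 * q - 2) j ((M d)⁻¹ *ᵥ x) := by
    intro x
    simp only [projection, Set.mem_iUnion, geodesicHull, Set.mem_inter_iff, SetLike.mem_coe]
    constructor
    · rintro ⟨d, hd, hx, hxd⟩
      exact ⟨hx, d, hd, (D.mem_hull_iff h hn hd).1 hxd⟩
    · rintro ⟨hx, d, hd, hxd⟩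
      exact ⟨d, hd, hx, (D.mem_hull_iff h hn hd).2 hxd⟩
  refine ⟨fun x hx => ((hmem x).1 hx).1, ?_, ?_⟩
  · rintro x hx y hy - z ⟨hz, hzxy⟩
    obtain ⟨-, d₁, hd₁, hx⟩ := (hmem x).1 hx
    obtain ⟨-, d₂, hd₂, hy⟩ := (hmem y).1 hy
    rw [hmem]
    refine ⟨hz, ?_⟩
    obtain ⟨u, v, rfl⟩ := Submodule.mem_span_pair.1 hzxy
    obtain ⟨a, d, s, t, H, ha, hd⟩ := h.exists_faceChain hd₁ hd₂
    have hface : ∀ d d' : G.Dart, d ∈ P.bounded → P.next.SameCycle d d' → ∀ x,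
        (∀ j, 0 ≤ edgeFun r (2 * q - 2) j ((M d)⁻¹ *ᵥ x)) →
        ∀ j, 0 ≤ edgeFun r (2 * q - 2) j ((M d')⁻¹ *ᵥ x) := by
      intro d d' hd hdd' x hx
      have hd' : d' ∈ P.bounded := by
        obtain ⟨i, -, rfl⟩ := h.exists_next_pow_eq hd hdd'
        exact P.next_pow_mem_bounded hd i
      rw [← D.mem_hull_iff h hn hd] at hx
      rw [← D.mem_hull_iff h hn hd']
      have hfv : P.faceVerts d' = P.faceVerts d := by
        ext v
        exact ⟨fun ⟨e, he, hev⟩ => ⟨e, hdd'.trans he, hev⟩,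
          fun ⟨e, he, hev⟩ => ⟨e, hdd'.symm.trans he, hev⟩⟩
      rw [hfv]
      exact hx
    exact D.exists_mem_face_of_nonneg_combination h hq H (hface _ _ hd₁ ha x hx) y
      (hface _ _ hd₂ hd.symm y hy) u v u.2 v.2
  · intro x hx hx'
    obtain ⟨v₀⟩ := h.connected.nonempty
    obtain ⟨d, hd, -⟩ := h.exists_bounded v₀
    by_contra! hA
    have hxm := ((hmem x).1 hx).1
    have hk : 0 < curvature r (2 * q - 2) := by
      by_contra! hk
      have h1 := hxm.2 hk
      have h2 := ((hmem (-x)).1 hx').1.2 hk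
      rw [Pi.neg_apply] at h2
      linarith
    -- If the projection were just an antipodal pair, every corner of a face, normalized to the
    -- sphere, would be `x` or `-x`. All corners would then be proportional, and hence equal, as
    -- they have the same nonzero height.
    have key : ∀ j, ∃ c : ℝ, corner r (2 * q - 2) j = c • ((M d)⁻¹ *ᵥ x) := by
      intro j
      obtain ⟨p, hp⟩ : ∃ p, p = M d *ᵥ corner r (2 * q - 2) j := ⟨_, rfl⟩
      have hp' : corner r (2 * q - 2) j = (M d)⁻¹ *ᵥ p := by rw [hp, D.inv_mulVec_mulVec hd]
      have hQ : 0 < curvature r (2 * q - 2) * (p 0 ^ 2 + p 1 ^ 2) + p 2 ^ 2 := by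
        by_contra! hQ
        have h01 : 0 ≤ curvature r (2 * q - 2) * (p 0 ^ 2 + p 1 ^ 2) := by positivity
        have h2 : p 2 ^ 2 = 0 := by linarith [sq_nonneg (p 2)]
        have h3 : p 0 ^ 2 + p 1 ^ 2 = 0 := by
          have : curvature r (2 * q - 2) * (p 0 ^ 2 + p 1 ^ 2) = 0 := by
            linarith [sq_nonneg (p 2)]
          exact (mul_eq_zero.1 this).resolve_left hk.ne'
        have hp0 : p = 0 := by
          ext i
          fin_cases i
          · exact pow_eq_zero_iff two_ne_zero |>.1
              (show p 0 ^ 2 = 0 by linarith [sq_nonneg (p 0), sq_nonneg (p 1)])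
          · exact pow_eq_zero_iff two_ne_zero |>.1
              (show p 1 ^ 2 = 0 by linarith [sq_nonneg (p 0), sq_nonneg (p 1)])
          · exact pow_eq_zero_iff two_ne_zero |>.1 h2
        rw [hp0, mulVec_zero] at hp'
        have := congrFun hp' 2
        exact (height_pos hr hn).ne' this
      have hs := Real.sqrt_pos.2 hQ
      have hss := Real.sq_sqrt hQ.le
      set s := √(curvature r (2 * q - 2) * (p 0 ^ 2 + p 1 ^ 2) + p 2 ^ 2)
      have hw : s⁻¹ • p ∈ P.projection f := by
        refine (hmem _).2 ⟨⟨?_, fun h => absurd hk h.not_gt⟩, d, hd, fun i => ?_⟩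
        · simp only [Pi.smul_apply, smul_eq_mul]
          field_simp
          linarith
        · rw [mulVec_smul, edgeFun_smul, ← hp']
          exact mul_nonneg (inv_nonneg.2 hs.le) (edgeFun_corner_nonneg hr hn i j)
      have hps : p = s • (s⁻¹ • p) := by rw [smul_smul, mul_inv_cancel₀ hs.ne', one_smul]
      by_cases hwx : s⁻¹ • p = x
      · exact ⟨s, by rw [hp', hps, hwx, mulVec_smul]⟩
      · exact ⟨-s, by rw [hp', hps, hA _ hw hwx, mulVec_smul, mulVec_neg, smul_neg, neg_smul]⟩
    obtain ⟨a, ha⟩ := key 0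
    obtain ⟨b, hb⟩ := key (-1)
    have h0 : height r (2 * q - 2) = a * ((M d)⁻¹ *ᵥ x) 2 := congrFun ha 2
    have h1 : height r (2 * q - 2) = b * ((M d)⁻¹ *ᵥ x) 2 := congrFun hb 2
    have hy : ((M d)⁻¹ *ᵥ x) 2 ≠ 0 := by
      intro hy
      rw [hy, mul_zero] at h0
      exact (height_pos hr hn).ne' h0
    have hab : a = b := mul_right_cancel₀ hy (h0.symm.trans h1)
    have := corner_injective_of_lt hr hn (i := 0) (j := -1) (by omega) (by omega)
      (by rw [ha, hb, hab])
    omega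

end PlaneMap

theorem theorem4 {V : Type u} (G : SimpleGraph V) :
    (∀ r q : ℕ, 3 ≤ r → 3 ≤ q → IsPolycycle r q G →
      ∀ P : PlaneMap G, P.IsPolycyclicRealization r q → P.IsOuterplanar →
        IsProperPolycycle r (2 * q - 2) G ∧
        (∃ f : G →g RegularPartition.skeleton r (2 * q - 2), P.IsCellHom r (2 * q - 2) f) ∧
        ∀ f : G →g RegularPartition.skeleton r (2 * q - 2), P.IsCellHom r (2 * q - 2) f →
          IsGeodesicallyConvex (RegularPartition.curvature r (2 * q - 2)) (P.projection f)) ∧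
    (∀ q : ℕ, 3 ≤ q → IsPolycycle 3 q G →
      ∀ P : PlaneMap G, P.IsPolycyclicRealization 3 q → P.IsOuterplanar →
        IsProperPolycycle 3 (q + 2) G) := by
  refine ⟨fun r q hr hq hG P hP ho => ?_, fun q hq hG P hP ho => ?_⟩
  · have h := hP.isOuterplanarRealization hr hG ho
    obtain ⟨M, pos, D⟩ := h.exists_isDevelopment (n := 2 * q - 2) (by omega)
    obtain ⟨f, hf, -⟩ := D.exists_hom h (by omega)
    exact ⟨PlaneMap.IsOuterplanarRealization.isProperPolycycle hr (by omega) (by omega) hG hP ho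
      fun M pos D => D.pos_injective h hq, ⟨f, hf⟩, fun f hf => h.isGeodesicallyConvex hq hf⟩
  · have h := hP.isOuterplanarRealization le_rfl hG ho
    exact PlaneMap.IsOuterplanarRealization.isProperPolycycle le_rfl (by omega) (by omega) hG hP ho
      fun M pos D => D.pos_injective_of_triangles h hq
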